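/- Let $n\ge 5$ and let $x_0,\dots,x_{n-1}$ be the vertices of a strictly convex $n$-gon in the plane, in counterclockwise order. Two edges $[x_u,x_v]$ and $[x_{u'},x_{v'}]$ (with $u\neq v$, $u'\ne v'$) cross if the open segments $]x_u,x_v[$ and $]x_{u'},x_{v'}[$ intersect. A $2$-triangulation of the $n$-gon is an inclusion-maximal set $T$ of edges between its vertices that contains no three mutually crossing edges; regard $T$ as a graph on the vertex set $V=\{0,\dots,n-1\}$. For a graph $G$ on $V$ and positions $p:V\to\mathbb{R}^d$ with the Euclidean metric, call $(G,p)$ rigid if for every continuous movement $\gamma:[0,1]\to(\mathbb{R}^d)^V$ with $\gamma(0)=p$ that preserves the lengths of all edges of $G$, and for every $t\in[0,1]$, there is an isometry $\varphi$ of $\mathbb{R}^d$ with $\gamma(t)_v=\varphi(p_v)$ for all $v\in V$. Call $(G,p)$ minimally rigid if it is rigid and $(H,p)$ is not rigid for any graph $H$ on $V$ whose edge set is a proper subset of that of $G$. Call $G$ generically minimally rigid in dimension $d$ if there is a nonzero polynomial $Q$ with rational coefficients in the $d|V|$ coordinates such that $(G,p)$ is minimally rigid for every $p$ with $Q(p)\neq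 0$. **Theorem.** Every $2$-triangulation of a convex $n$-gon with $n\ge 5$ is a generically minimally rigid graph in dimension $4$. -/

import Mathlib

namespace MultiTri

/-- The points `x 0, …, x (n - 1)` of the plane are the vertices of a (strictly) convex polygon,
labelled in counterclockwise order: every triple `x i, x j, x l` with `i < j < l` makes a strict
left turn. -/
def IsConvexPolygon {n : ℕ} (x : Fin n → EuclideanSpace ℝ (Fin 2)) : Prop :=
  ∀ i j l : Fin n, i < j → j < l →
    0 < (x j 0 - x i 0) * (x l 1 - x i 1) - (x j 1 - x i 1) * (x l 0 - x i 0)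

/-- Two edges `[u, v]` and `[u', v']` cross when the open segments `]u, v[` and `]u', v'[`
intersect. -/
def Cross {n : ℕ} (x : Fin n → EuclideanSpace ℝ (Fin 2)) (e f : Sym2 (Fin n)) : Prop :=
  ∃ u v u' v' : Fin n, e = s(u, v) ∧ f = s(u', v') ∧
    (openSegment ℝ (x u) (x v) ∩ openSegment ℝ (x u') (x v')).Nonempty

/-- An `ℓ`-crossing: a set of `ℓ` mutually crossing edges. -/
def IsCrossing {n : ℕ} (x : Fin n → EuclideanSpace ℝ (Fin 2)) (ℓ : ℕ)
    (C : Finset (Sym2 (Fin n))) : Prop :=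
  C.card = ℓ ∧ (C : Set (Sym2 (Fin n))).Pairwise (Cross x)

/-- A set of edges on the vertices of the polygon (a simple graph on `Fin n`) that contains no
`ℓ`-crossing. -/
def CrossingFree {n : ℕ} (x : Fin n → EuclideanSpace ℝ (Fin 2)) (ℓ : ℕ)
    (G : SimpleGraph (Fin n)) : Prop :=
  ∀ C : Finset (Sym2 (Fin n)), (C : Set (Sym2 (Fin n))) ⊆ G.edgeSet → ¬ IsCrossing x ℓ C

/-- A `k`-triangulation of the polygon `x`: an inclusion-maximal `(k + 1)`-crossing-free set of
edges. -/
def IsMultiTriangulation {n : ℕ} (x : Fin n → EuclideanSpace ℝ (Fin 2)) (k : ℕ)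
    (T : SimpleGraph (Fin n)) : Prop :=
  Maximal (CrossingFree x (k + 1)) T

/-- The framework `(G, p)` in `ℝ ^ d` is rigid: for every continuous movement `γ` of the vertices
that starts at `p` and preserves all edge lengths, the displacement of the vertices at every time
extends to an isometry of `ℝ ^ d`. -/
def IsRigid {V : Type*} {d : ℕ} (G : SimpleGraph V) (p : V → EuclideanSpace ℝ (Fin d)) : Prop :=
  ∀ γ : unitInterval → V → EuclideanSpace ℝ (Fin d), Continuous γ → γ 0 = p →
    (∀ t u v, G.Adj u v → dist (γ t u) (γ t v) = dist (p u) (p v)) →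
    ∀ t, ∃ φ : EuclideanSpace ℝ (Fin d) ≃ᵢ EuclideanSpace ℝ (Fin d), ∀ v, γ t v = φ (p v)

/-- The framework `(G, p)` is minimally rigid: it is rigid, and `(H, p)` is not rigid for any proper
spanning subgraph `H` of `G`. -/
def IsMinimallyRigid {V : Type*} {d : ℕ} (G : SimpleGraph V)
    (p : V → EuclideanSpace ℝ (Fin d)) : Prop :=
  Minimal (fun H : SimpleGraph V => IsRigid H p) G

/-- The graph `G` is generically minimally rigid in dimension `d`: for all sufficiently generic
positions `p` of the vertices in `ℝ ^ d` the framework `(G, p)` is minimally rigid. Sufficiently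
generic means outside the zero set of some nonzero polynomial with rational coefficients in the
coordinates; this includes all positions whose coordinates are algebraically independent
over `ℚ`. -/
def IsGenericallyMinimallyRigid {V : Type*} (d : ℕ) (G : SimpleGraph V) : Prop :=
  ∃ Q : MvPolynomial (V × Fin d) ℚ, Q ≠ 0 ∧
    ∀ p : V → EuclideanSpace ℝ (Fin d),
      MvPolynomial.aeval (fun vi : V × Fin d => p vi.1 vi.2) Q ≠ (0 : ℝ) →
        IsMinimallyRigid G p

end MultiTri

/-!
A `2`-triangulation on `n ≥ 6` vertices is a vertex split, in Whiteley's sense, of a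
`2`-triangulation on `n - 1` vertices, so its rows in the rigidity matrix of dimension four are
generically independent by induction from `K₅`; the same induction counts at least
`4 n - 10` edges, and a generic independent framework with that many edges is minimally rigid.

*Combinatorics.* In the linear order of the labels, a shortest edge with at least two vertices
between its endpoints has exactly two of them, `a` and `b`, between: otherwise a non-edge below it
would cross two crossing edges that also cross the edge itself (`IsTwoTriangulation.exists_ear`). All
edges from `a` and `b` to the other side cross the ear `u v`, so no two of them cross each other;
hence `a` and `b` have at most one common neighbour there, and maximality provides one
(`IsTwoTriangulation.exists_common`). Together with `u` and `v` they have exactly three common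
neighbours, and the contraction of `a b` is again a `2`-triangulation
(`IsTwoTriangulation.exists_contract`).

*Linear algebra.* Independence of the rows is stated as the possibility of prescribing the
first-order changes of all edge lengths (`EdgesIndependent`). If `b` is placed at `a` with `a b`
pointing in a generic direction, the velocity of `b` relative to `a` is determined by the edge
`a b` and the three common neighbours, and the rest is the contracted framework; independence is
open, so `b` can be moved off `a` (`exists_edgesIndependent_of_contract`). The Gram determinant of
the rigidity matrix is the polynomial with rational coefficients that detects independence
(`aeval_gramPoly_ne_zero_iff`).

*From infinitesimal to continuous rigidity.* By the edge count the kernel of the rigidity matrix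
consists of infinitesimal isometries (`EdgesIndependent.isInfinitesimallyRigid`). If `q` has the
same edge lengths as `p`, then `q - p` is an infinitesimal motion of the midpoint `(p + q) / 2`,
hence trivial, and `q` is congruent to `p` when `q` is close to `p`; connectedness of the time
interval gives rigidity (`isRigid_of_eventually`). Conversely, by the inverse function theorem,
independence allows the length of a single edge to be changed by a movement that keeps all the
others (`EdgesIndependent.exists_movement`), so no proper subgraph is rigid.
-/

namespace MultiTri

/-! ### Two-triangulations of labelled vertex sets -/

/-- Two pairs `{p, q}` and `{r, s}` of natural numbers interleave: exactly one of `r`, `s` lies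
strictly between `p` and `q`, and the other one lies strictly outside. -/
def Interleave (p q r s : ℕ) : Prop :=
  (p < r ∧ r < q ∧ (s < p ∨ q < s)) ∨ (p < s ∧ s < q ∧ (r < p ∨ q < r)) ∨
  (q < r ∧ r < p ∧ (s < q ∨ p < s)) ∨ (q < s ∧ s < p ∧ (r < q ∨ p < r))

/-- The pairs `{p, q}` and `{r, s}` of vertices cross, when the vertices are put on a circle in the
cyclic order of their labels. -/
def Crosses {V : Type*} (ℓ : V → ℕ) (p q r s : V) : Prop :=
  Interleave (ℓ p) (ℓ q) (ℓ r) (ℓ s)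

/-- The purely combinatorial form of a `2`-triangulation: the labels are distinct, the vertices in
`S` are placed on a circle in the cyclic order of their labels, `G` is a graph on `S` without three
mutually crossing edges, and every pair of vertices of `S` that is not an edge crosses two crossing
edges. -/
structure IsTwoTriangulation {V : Type*} (ℓ : V → ℕ) (S : Finset V) (G : SimpleGraph V) :
    Prop where
  inj : Function.Injective ℓ
  mem : ∀ {x y}, G.Adj x y → x ∈ S
  free : ∀ p q r s t w, G.Adj p q → G.Adj r s → G.Adj t w →
    Crosses ℓ p q r s → Crosses ℓ p q t w → Crosses ℓ r s t w → False
  sat : ∀ x ∈ S, ∀ y ∈ S, x ≠ y → ¬ G.Adj x y → ∃ p q r s, G.Adj p q ∧ G.Adj r s ∧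
    Crosses ℓ x y p q ∧ Crosses ℓ x y r s ∧ Crosses ℓ p q r s

/-- The contraction of `b` into `a`; the vertex `b` becomes isolated. -/
def contract {V : Type*} (G : SimpleGraph V) (a b : V) : SimpleGraph V where
  Adj x y := x ≠ y ∧ x ≠ b ∧ y ≠ b ∧
    (G.Adj x y ∨ (x = a ∧ G.Adj b y) ∨ (y = a ∧ G.Adj x b))
  symm := ⟨fun x y h => ⟨h.1.symm, h.2.2.1, h.2.1, by
    rcases h.2.2.2 with h | h | h
    · exact Or.inl h.symm
    · exact Or.inr (Or.inr ⟨h.1, h.2.symm⟩)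
    · exact Or.inr (Or.inl ⟨h.1, h.2.symm⟩)⟩⟩
  loopless := ⟨fun x h => h.1 rfl⟩

namespace IsTwoTriangulation

variable {V : Type*} {ℓ : V → ℕ} {S : Finset V} {G : SimpleGraph V}

/-- The saturation condition for a non-edge with its two crossing edges in standard position:
`c` and `d` between `x` and `y`, followed by `e` and `f` in the cyclic order. -/
theorem exists_of_not_adj (h : IsTwoTriangulation ℓ S G) {x y : V} (hx : x ∈ S) (hy : y ∈ S)
    (hxy : ℓ x < ℓ y) (hn : ¬ G.Adj x y) :
    ∃ c d e f, G.Adj c e ∧ G.Adj d f ∧ ℓ x < ℓ c ∧ ℓ c < ℓ d ∧ ℓ d < ℓ y ∧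
      ((ℓ y < ℓ e ∧ ℓ e < ℓ f) ∨ (ℓ y < ℓ e ∧ ℓ f < ℓ x) ∨ (ℓ e < ℓ f ∧ ℓ f < ℓ x)) := by
  have hne : x ≠ y := by rintro rfl; omega
  obtain ⟨p, q, r, s, h1, h2, c1, c2, c3⟩ := h.sat x hx y hy hne hn
  -- orient both edges so that their first endpoint lies between `x` and `y`
  have key : ∀ p q, G.Adj p q → Crosses ℓ x y p q → ∃ p' q', G.Adj p' q' ∧
      (p' = p ∧ q' = q ∨ p' = q ∧ q' = p) ∧
      ℓ x < ℓ p' ∧ ℓ p' < ℓ y ∧ (ℓ q' < ℓ x ∨ ℓ y < ℓ q') := by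
    intro p q h1 c1
    unfold Crosses Interleave at c1
    rcases c1 with c1 | c1 | c1 | c1
    · exact ⟨p, q, h1, Or.inl ⟨rfl, rfl⟩, by omega⟩
    · exact ⟨q, p, h1.symm, Or.inr ⟨rfl, rfl⟩, by omega⟩
    · omega
    · omega
  obtain ⟨p', q', a1, e1, b1⟩ := key p q h1 c1
  obtain ⟨r', s', a2, e2, b2⟩ := key r s h2 c2
  have c3' : Crosses ℓ p' q' r' s' := by
    unfold Crosses Interleave at c3 ⊢
    rcases e1 with ⟨rfl, rfl⟩ | ⟨rfl, rfl⟩ <;> rcases e2 with ⟨rfl, rfl⟩ | ⟨rfl, rfl⟩ <;> omega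
  unfold Crosses Interleave at c3'
  rcases lt_or_ge (ℓ p') (ℓ r') with hlt | hge
  · exact ⟨p', r', q', s', a1, a2, by omega⟩
  · exact ⟨r', p', s', q', a2, a1, by omega⟩

theorem mem_right (h : IsTwoTriangulation ℓ S G) {x y : V} (hxy : G.Adj x y) : y ∈ S :=
  h.mem hxy.symm

/-- Relabelling by rotating the circle. -/
theorem rotate (h : IsTwoTriangulation ℓ S G) {M : ℕ} (hM : ∀ z, ℓ z < M) (u : V) :
    IsTwoTriangulation (fun z => if ℓ z < ℓ u then ℓ z + M else ℓ z) S G := by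
  have hX : ∀ p q r s, Crosses (fun z => if ℓ z < ℓ u then ℓ z + M else ℓ z) p q r s ↔
      Crosses ℓ p q r s := by
    intro p q r s
    have := hM p; have := hM q; have := hM r; have := hM s
    unfold Crosses Interleave
    dsimp only
    split_ifs <;> omega
  refine ⟨?_, h.mem, ?_, ?_⟩
  · intro x y hxy
    apply h.inj
    have := hM x; have := hM y
    dsimp only at hxy
    split_ifs at hxy <;> omega
  · simpa only [hX] using h.free
  · simpa only [hX] using h.sat

/-- Every edge with at least two vertices strictly between its endpoints spans an edge with exactly
two vertices strictly between its endpoints. -/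
theorem exists_ear_aux (h : IsTwoTriangulation ℓ S G) (m : ℕ) : ∀ u v a b : V,
    ℓ v - ℓ u ≤ m → G.Adj u v → a ∈ S → b ∈ S → ℓ u < ℓ a → ℓ a < ℓ b → ℓ b < ℓ v →
    ∃ u v a b : V, G.Adj u v ∧ a ∈ S ∧ b ∈ S ∧ ℓ u < ℓ a ∧ ℓ a < ℓ b ∧ ℓ b < ℓ v ∧
      ∀ z ∈ S, ℓ u ≤ ℓ z → ℓ z ≤ ℓ v → z = u ∨ z = a ∨ z = b ∨ z = v := by
  induction m with
  | zero => intro u v a b; omega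
  | succ m ih =>
    intro u v a₀ b₀ hm huv ha₀ hb₀ h1 h2 h3
    -- the first two vertices `a`, `b` of `S` after `u`
    obtain ⟨a, ha, hamin⟩ := Finset.exists_min_image (S.filter fun z => ℓ u < ℓ z) ℓ
      ⟨a₀, by simp [ha₀, h1]⟩
    simp only [Finset.mem_filter] at ha hamin
    have haa : ℓ a ≤ ℓ a₀ := hamin a₀ ⟨ha₀, h1⟩
    obtain ⟨b, hb, hbmin⟩ := Finset.exists_min_image (S.filter fun z => ℓ a < ℓ z) ℓ
      ⟨b₀, by simp only [Finset.mem_filter]; exact ⟨hb₀, by omega⟩⟩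
    simp only [Finset.mem_filter] at hb hbmin
    have hbb : ℓ b ≤ ℓ b₀ := hbmin b₀ ⟨hb₀, by omega⟩
    obtain ⟨w, hw, hwmin⟩ := Finset.exists_min_image (S.filter fun z => ℓ b < ℓ z) ℓ
      ⟨v, by simp only [Finset.mem_filter]; exact ⟨h.mem_right huv, by omega⟩⟩
    simp only [Finset.mem_filter] at hw hwmin
    have hwv : ℓ w ≤ ℓ v := hwmin v ⟨h.mem_right huv, by omega⟩
    have cons : ∀ z ∈ S, ℓ u ≤ ℓ z → ℓ z ≤ ℓ w → z = u ∨ z = a ∨ z = b ∨ z = w := by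
      intro z hz hz1 hz2
      have e1 := hamin z
      have e2 := hbmin z
      have e3 := hwmin z
      have : ℓ z = ℓ u ∨ ℓ z = ℓ a ∨ ℓ z = ℓ b ∨ ℓ z = ℓ w := by
        by_contra hc
        push Not at hc
        have i1 := e1 ⟨hz, by omega⟩
        have i2 := e2 ⟨hz, by omega⟩
        have i3 := e3 ⟨hz, by omega⟩
        omega
      simpa only [h.inj.eq_iff] using this
    by_cases huw : G.Adj u w
    · exact ⟨u, w, a, b, huw, ha.1, hb.1, ha.2, hb.2, hw.2, cons⟩
    obtain ⟨c, d, e, f, ce, df, i1, i2, i3, i4⟩ :=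
      h.exists_of_not_adj (h.mem huv) hw.1 (by omega) huw
    have hc : c = a := by
      have j1 := cons c (h.mem ce) (by omega) (by omega)
      have j2 := cons d (h.mem df) (by omega) (by omega)
      rcases j1 with rfl | rfl | rfl | rfl <;> rcases j2 with rfl | rfl | rfl | rfl <;>
        first | rfl | omega
    have hd : d = b := by
      have j2 := cons d (h.mem df) (by omega) (by omega)
      subst hc
      rcases j2 with rfl | rfl | rfl | rfl <;> first | rfl | omega
    subst hc hd
    by_cases hev : ℓ w < ℓ e ∧ ℓ e ≤ ℓ v
    · exact ih c e d w (by omega) ce hb.1 hw.1 hb.2 hw.2 hev.1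
    · exfalso
      have hvw : ℓ w < ℓ v := by
        rcases hwv.lt_or_eq with hlt | heq
        · exact hlt
        · exact absurd (h.inj heq ▸ huv) huw
      refine h.free u v c e d f huv ce df ?_ ?_ ?_ <;> unfold Crosses Interleave <;> omega

/-- A two-triangulation with at least five vertices has an ear: an edge `u v` with exactly two
vertices `a`, `b` strictly on one of its sides. -/
theorem exists_ear (h : IsTwoTriangulation ℓ S G) (hS : 5 ≤ S.card) :
    ∃ u v a b : V, G.Adj u v ∧ a ∈ S ∧ b ∈ S ∧ ℓ u < ℓ a ∧ ℓ a < ℓ b ∧ ℓ b < ℓ v ∧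
      ∀ z ∈ S, ℓ u ≤ ℓ z → ℓ z ≤ ℓ v → z = u ∨ z = a ∨ z = b ∨ z = v := by
  classical
  obtain ⟨u, hu, humin⟩ := Finset.exists_min_image S ℓ (Finset.card_pos.1 (by omega))
  obtain ⟨v, hv, hvmax⟩ := Finset.exists_max_image S ℓ (Finset.card_pos.1 (by omega))
  have hc : 2 ≤ ((S.erase u).erase v).card := by
    have := Finset.pred_card_le_card_erase (s := S) (a := u)
    have := Finset.pred_card_le_card_erase (s := S.erase u) (a := v)
    omega
  obtain ⟨a, ha, b, hb, hab⟩ := Finset.one_lt_card.1 hc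
  simp only [Finset.mem_erase] at ha hb
  have n1 := h.inj.ne hab
  have n2 := h.inj.ne ha.1
  have n3 := h.inj.ne ha.2.1
  have n4 := h.inj.ne hb.1
  have n5 := h.inj.ne hb.2.1
  have l1 := humin a ha.2.2
  have l2 := humin b hb.2.2
  have l3 := hvmax a ha.2.2
  have l4 := hvmax b hb.2.2
  have huv : G.Adj u v := by
    by_contra hn
    obtain ⟨c, d, e, f, ce, df, i1, i2, i3, i4⟩ := h.exists_of_not_adj hu hv (by omega) hn
    have := humin f (h.mem_right df)
    have := hvmax e (h.mem_right ce)
    omega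
  rcases lt_or_gt_of_ne n1 with hlt | hlt
  · exact h.exists_ear_aux _ u v a b le_rfl huv ha.2.2 hb.2.2 (by omega) hlt (by omega)
  · exact h.exists_ear_aux _ u v b a le_rfl huv hb.2.2 ha.2.2 (by omega) hlt (by omega)

/-- With at most five vertices, a two-triangulation is complete. -/
theorem adj_of_card_le (h : IsTwoTriangulation ℓ S G) (hS : S.card ≤ 5) {x y : V} (hx : x ∈ S)
    (hy : y ∈ S) (hxy : x ≠ y) : G.Adj x y := by
  classical
  wlog hlt : ℓ x < ℓ y generalizing x y
  · have hne := h.inj.ne hxy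
    exact (this hy hx hxy.symm (by omega)).symm
  by_contra hn
  obtain ⟨c, d, e, f, ce, df, i1, i2, i3, i4⟩ := h.exists_of_not_adj hx hy hlt hn
  have hsub : ({x, y, c, d, e, f} : Finset V).image ℓ ⊆ S.image ℓ := by
    apply Finset.image_subset_image
    intro z hz
    simp only [Finset.mem_insert, Finset.mem_singleton] at hz
    rcases hz with rfl | rfl | rfl | rfl | rfl | rfl
    exacts [hx, hy, h.mem ce, h.mem df, h.mem_right ce, h.mem_right df]
  have hle := (Finset.card_le_card hsub).trans Finset.card_image_le
  simp only [Finset.image_insert, Finset.image_singleton] at hle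
  have h6 : ({ℓ x, ℓ y, ℓ c, ℓ d, ℓ e, ℓ f} : Finset ℕ).card = 6 := by
    rw [Finset.card_insert_of_notMem, Finset.card_insert_of_notMem, Finset.card_insert_of_notMem,
      Finset.card_insert_of_notMem, Finset.card_insert_of_notMem, Finset.card_singleton] <;>
    simp only [Finset.mem_insert, Finset.mem_singleton] <;> omega
  omega

end IsTwoTriangulation

/-! ### Contracting an ear -/

/-- The edge `u v` cuts off exactly the vertices `a` and `b`, and the labels are rotated such that
`u`, `a`, `b`, `v` are the first four vertices of `S`. -/
structure IsEar {V : Type*} (ℓ : V → ℕ) (S : Finset V) (G : SimpleGraph V) (u a b v : V) :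
    Prop where
  adj : G.Adj u v
  mem_a : a ∈ S
  mem_b : b ∈ S
  ua : ℓ u < ℓ a
  ab : ℓ a < ℓ b
  bv : ℓ b < ℓ v
  rest : ∀ z ∈ S, z = u ∨ z = a ∨ z = b ∨ z = v ∨ ℓ v < ℓ z

/-- An edge of the contraction lifts to an edge of `G` by moving an endpoint from `a` to `b` if
necessary. -/
theorem exists_adj_of_contract_adj {V : Type*} {G : SimpleGraph V} [DecidableEq V]
    {a b p q : V}
    (hpq : (contract G a b).Adj p q) :
    ∃ p' q', G.Adj p' q' ∧ (if p' = b then a else p') = p ∧ (if q' = b then a else q') = q := by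
  obtain ⟨-, hp, hq, h | ⟨rfl, h⟩ | ⟨rfl, h⟩⟩ := hpq
  · exact ⟨p, q, h, by simp [hp], by simp [hq]⟩
  · exact ⟨b, q, h, by simp, by simp [hq]⟩
  · exact ⟨p, b, h, by simp [hp], by simp⟩

theorem contract_adj_of_adj {V : Type*} {G : SimpleGraph V} [DecidableEq V]
    {a b p q : V} (hab : a ≠ b)
    (hpq : G.Adj p q) (hne : (if p = b then a else p) ≠ (if q = b then a else q)) :
    (contract G a b).Adj (if p = b then a else p) (if q = b then a else q) := by
  refine ⟨hne, ?_, ?_, ?_⟩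
  · split_ifs <;> assumption
  · split_ifs <;> assumption
  · by_cases hp : p = b <;> by_cases hq : q = b
    · subst hp hq; exact absurd hpq (G.irrefl)
    · subst hp; simp [hq, hpq]
    · subst hq; simp [hp, hpq]
    · simp [hp, hq, hpq]

theorem Interleave.mono {p q r s p' q' r' s' : ℕ} (h : Interleave p q r s)
    (pr : p < r → p' < r') (ps : p < s → p' < s') (qr : q < r → q' < r') (qs : q < s → q' < s')
    (rp : r < p → r' < p') (sp : s < p → s' < p') (rq : r < q → r' < q') (sq : s < q → s' < q') :
    Interleave p' q' r' s' := by
  rcases h with ⟨h1, h2, h3⟩ | ⟨h1, h2, h3⟩ | ⟨h1, h2, h3⟩ | ⟨h1, h2, h3⟩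
  · exact Or.inl ⟨pr h1, rq h2, h3.imp sp qs⟩
  · exact Or.inr (Or.inl ⟨ps h1, sq h2, h3.imp rp qr⟩)
  · exact Or.inr (Or.inr (Or.inl ⟨qr h1, rp h2, h3.imp sq ps⟩))
  · exact Or.inr (Or.inr (Or.inr ⟨qs h1, sp h2, h3.imp rq pr⟩))

namespace IsTwoTriangulation

variable {V : Type*} {ℓ : V → ℕ} {S : Finset V} {G : SimpleGraph V}

theorem exists_isEar [Finite V] (h : IsTwoTriangulation ℓ S G) (hS : 5 ≤ S.card) :
    ∃ (ℓ' : V → ℕ) (u a b v : V), IsTwoTriangulation ℓ' S G ∧ IsEar ℓ' S G u a b v := by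
  obtain ⟨u, v, a, b, huv, ha, hb, h1, h2, h3, h4⟩ := h.exists_ear hS
  obtain ⟨M, hM⟩ := (Set.finite_range ℓ).bddAbove
  have hM' : ∀ z, ℓ z < M + 1 := fun z => Nat.lt_succ_of_le (hM ⟨z, rfl⟩)
  refine ⟨_, u, a, b, v, h.rotate hM' u, huv, ha, hb, ?_, ?_, ?_, ?_⟩
  · split_ifs <;> omega
  · split_ifs <;> omega
  · split_ifs <;> omega
  · intro z hz
    by_cases hu : ℓ z < ℓ u
    · have := hM' v
      right; right; right; right
      split_ifs <;> omega
    by_cases hv : ℓ v < ℓ z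
    · right; right; right; right
      split_ifs <;> omega
    · have := h4 z hz (by omega) (by omega)
      tauto

/-- Edges from the two inner vertices of an ear to the vertices outside the ear do not cross, as
they all cross the edge `u v`. -/
theorem le_of_adj_of_adj (h : IsTwoTriangulation ℓ S G) {u a b v : V} (he : IsEar ℓ S G u a b v)
    {x y : V} (hx : G.Adj a x) (hy : G.Adj b y) (hvx : ℓ v < ℓ x) (hvy : ℓ v < ℓ y) :
    ℓ y ≤ ℓ x := by
  by_contra hlt
  have := he.ua; have := he.ab; have := he.bv
  refine h.free u v a x b y he.adj hx hy ?_ ?_ ?_ <;> unfold Crosses Interleave <;> omega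

theorem adj_inner (h : IsTwoTriangulation ℓ S G) {u a b v : V} (he : IsEar ℓ S G u a b v) :
    G.Adj a b ∧ G.Adj a u ∧ G.Adj b u ∧ G.Adj a v ∧ G.Adj b v := by
  have hu := h.mem he.adj
  have hv := h.mem_right he.adj
  have h1 := he.ua; have h2 := he.ab; have h3 := he.bv
  have key : ∀ x ∈ S, ∀ y ∈ S, ℓ x < ℓ y → ℓ u ≤ ℓ x → ℓ y ≤ ℓ v → (x ≠ u ∨ y ≠ v) →
      G.Adj x y := by
    intro x hx y hy hxy hux hyv hne
    by_contra hn
    obtain ⟨c, d, e, f, ce, df, i1, i2, i3, i4⟩ := h.exists_of_not_adj hx hy hxy hn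
    rcases he.rest c (h.mem ce) with rfl | rfl | rfl | rfl | hc <;>
    rcases he.rest d (h.mem df) with rfl | rfl | rfl | rfl | hd <;>
    try omega
    rcases he.rest x hx with rfl | rfl | rfl | rfl | hx <;>
    rcases he.rest y hy with rfl | rfl | rfl | rfl | hy <;>
    first | omega | simp at hne
  have n : ∀ x y : V, ℓ x < ℓ y → x ≠ y := by rintro x y hxy rfl; omega
  refine ⟨key a he.mem_a b he.mem_b h2 h1.le h3.le (Or.inl (n u a h1).symm),
    (key u hu a he.mem_a h1 le_rfl (by omega) (Or.inr (n a v (by omega)))).symm,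
    (key u hu b he.mem_b (by omega) le_rfl (by omega) (Or.inr (n b v h3))).symm,
    key a he.mem_a v hv (by omega) h1.le le_rfl (Or.inl (n u a h1).symm),
    key b he.mem_b v hv (by omega) (by omega) le_rfl (Or.inl (n u b (by omega)).symm)⟩

/-- The two inner vertices of an ear have a common neighbour outside the ear: the last neighbour
of `b` is also a neighbour of `a`. -/
theorem exists_common (h : IsTwoTriangulation ℓ S G) (hS : 5 ≤ S.card) {u a b v : V}
    (he : IsEar ℓ S G u a b v) : ∃ s, ℓ v < ℓ s ∧ G.Adj a s ∧ G.Adj b s := by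
  classical
  have h1 := he.ua; have h2 := he.ab; have h3 := he.bv
  have hne : (S.filter fun z => ℓ v < ℓ z).Nonempty := by
    by_contra hc
    rw [Finset.not_nonempty_iff_eq_empty, Finset.filter_eq_empty_iff] at hc
    have hsub : S ⊆ {u, a, b, v} := by
      intro z hz
      have := he.rest z hz
      have := hc hz
      simp only [Finset.mem_insert, Finset.mem_singleton]
      tauto
    have := (Finset.card_le_card hsub).trans Finset.card_le_four
    omega
  obtain ⟨t, ht, htmin⟩ := Finset.exists_min_image _ ℓ hne
  simp only [Finset.mem_filter] at ht htmin
  have hbt : G.Adj b t := by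
    by_contra hn
    obtain ⟨c, d, e, f, ce, df, i1, i2, i3, i4⟩ :=
      h.exists_of_not_adj he.mem_b ht.1 (by omega) hn
    have := htmin d
    rcases he.rest d (h.mem df) with rfl | rfl | rfl | rfl | hd
    · omega
    · omega
    · omega
    · rcases he.rest c (h.mem ce) with rfl | rfl | rfl | rfl | hc <;> omega
    · have := htmin d ⟨h.mem df, hd⟩
      omega
  obtain ⟨s, hs, hsmax⟩ := Finset.exists_max_image (S.filter fun z => ℓ v < ℓ z ∧ G.Adj b z) ℓ
    ⟨t, by simp only [Finset.mem_filter]; exact ⟨ht.1, ht.2, hbt⟩⟩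
  simp only [Finset.mem_filter] at hs hsmax
  refine ⟨s, hs.2.1, ?_, hs.2.2⟩
  by_contra hn
  obtain ⟨c, d, e, f, ce, df, i1, i2, i3, i4⟩ :=
    h.exists_of_not_adj he.mem_a hs.1 (by omega) hn
  have hu : ∀ z ∈ S, ℓ z < ℓ a → z = u := by
    intro z hz hza
    rcases he.rest z hz with rfl | rfl | rfl | rfl | hz' <;> first | rfl | omega
  have hef : ℓ s < ℓ e := by
    rcases i4 with i4 | i4 | i4
    · omega
    · omega
    · have := hu e (h.mem_right ce) (by omega)
      have := hu f (h.mem_right df) (by omega)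
      subst e f
      omega
  have hcb : ℓ b < ℓ c := by
    rcases he.rest c (h.mem ce) with rfl | rfl | rfl | rfl | hc
    · omega
    · omega
    · have := hsmax e ⟨h.mem_right ce, by omega, ce⟩
      omega
    · omega
    · omega
  refine h.free b s c e d f hs.2.2 ce df ?_ ?_ ?_ <;> unfold Crosses Interleave <;> omega

theorem free_contract [DecidableEq V] (h : IsTwoTriangulation ℓ S G) {u a b v : V}
    (he : IsEar ℓ S G u a b v) (p q r s t w : V) (h1 : (contract G a b).Adj p q)
    (h2 : (contract G a b).Adj r s) (h3 : (contract G a b).Adj t w)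
    (c1 : Crosses ℓ p q r s) (c2 : Crosses ℓ p q t w) (c3 : Crosses ℓ r s t w) : False := by
  obtain ⟨p', q', g1, rfl, rfl⟩ := exists_adj_of_contract_adj h1
  obtain ⟨r', s', g2, rfl, rfl⟩ := exists_adj_of_contract_adj h2
  obtain ⟨t', w', g3, rfl, rfl⟩ := exists_adj_of_contract_adj h3
  -- collapsing `b` to `a` is weakly monotone on `S`
  have mono : ∀ x ∈ S, ∀ y ∈ S, ℓ (if x = b then a else x) < ℓ (if y = b then a else y) →
      ℓ x < ℓ y := by
    intro x hx y hy
    have := he.ab; have := he.ua; have := he.bv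
    have hy' := he.rest y hy
    split_ifs with i j j
    · omega
    · intro hlt
      subst i
      rcases hy' with rfl | rfl | rfl | rfl | hy' <;> first | omega | exact absurd rfl j
    · subst j; intro hlt; omega
    · exact id
  have lift : ∀ {p q r s}, G.Adj p q → G.Adj r s →
      Crosses ℓ (if p = b then a else p) (if q = b then a else q) (if r = b then a else r)
        (if s = b then a else s) → Crosses ℓ p q r s := by
    intro p q r s k1 k2 hc
    have mp := h.mem k1; have mq := h.mem_right k1
    have mr := h.mem k2; have ms := h.mem_right k2
    exact Interleave.mono hc (mono p mp r mr) (mono p mp s ms) (mono q mq r mr) (mono q mq s ms)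
      (mono r mr p mp) (mono s ms p mp) (mono r mr q mq) (mono s ms q mq)
  exact h.free p' q' r' s' t' w' g1 g2 g3 (lift g1 g2 c1) (lift g1 g3 c2) (lift g2 g3 c3)

/-- Saturation of the contraction at the pairs that avoid the contracted vertex. -/
theorem sat_contract_of_ne [DecidableEq V] (h : IsTwoTriangulation ℓ S G) {u a b v : V}
    (he : IsEar ℓ S G u a b v) {x y : V} (hx : x ∈ S) (hy : y ∈ S) (hxa : x ≠ a) (hxb : x ≠ b)
    (hya : y ≠ a) (hyb : y ≠ b) (hxy : ℓ x < ℓ y) (hn : ¬ G.Adj x y) :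
    ∃ p q r s, (contract G a b).Adj p q ∧ (contract G a b).Adj r s ∧
      Crosses ℓ x y p q ∧ Crosses ℓ x y r s ∧ Crosses ℓ p q r s := by
  have h1 := he.ua; have h2 := he.ab; have h3 := he.bv
  obtain ⟨c, d, e, f, ce, df, i1, i2, i3, i4⟩ := h.exists_of_not_adj hx hy hxy hn
  have ne_of : ∀ {x y : V}, ℓ x < ℓ y → x ≠ y := by rintro x y hxy rfl; omega
  have hnab : ∀ z ∈ S, z ≠ a → z ≠ b → ℓ z < ℓ a ∨ ℓ b < ℓ z := by
    intro z hz hza hzb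
    rcases he.rest z hz with rfl | rfl | rfl | rfl | hz' <;> first | omega | contradiction
  have hxs := hnab x hx hxa hxb
  have hys := hnab y hy hya hyb
  -- a crossing of an edge at `a` with an edge at `b` would be lost, but there is none
  have hcd : ¬ (c = a ∧ d = b) := by
    rintro ⟨rfl, rfl⟩
    have hxu : x = u := by
      rcases he.rest x hx with rfl | rfl | rfl | rfl | hz' <;> first | rfl | omega
    subst hxu
    have hvy : ℓ v ≤ ℓ y := by
      rcases he.rest y hy with rfl | rfl | rfl | rfl | hz' <;> omega
    have := fun k1 k2 => h.le_of_adj_of_adj he ce df k1 k2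
    rcases i4 with i4 | i4 | i4
    · have := this (by omega) (by omega)
      omega
    · rcases he.rest f (h.mem_right df) with rfl | rfl | rfl | rfl | hz' <;> omega
    · rcases he.rest f (h.mem_right df) with rfl | rfl | rfl | rfl | hz' <;> omega
  have hef : ¬ (e = a ∧ f = b) := by
    rintro ⟨rfl, rfl⟩
    rcases i4 with i4 | i4 | i4
    · rcases he.rest x hx with rfl | rfl | rfl | rfl | hx' <;>
      rcases he.rest y hy with rfl | rfl | rfl | rfl | hy' <;> omega
    · omega
    · have hvx : ℓ v ≤ ℓ x := by
        rcases he.rest x hx with rfl | rfl | rfl | rfl | hz' <;> omega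
      have := h.le_of_adj_of_adj he ce.symm df.symm (by omega) (by omega)
      omega
  have hfe : ¬ (e = b ∧ f = a) := by
    rintro ⟨rfl, rfl⟩
    omega
  -- comparisons that survive the collapse of `b` to `a`
  have mono : ∀ z ∈ S, ∀ w ∈ S, ¬ (z = a ∧ w = b) → ℓ z < ℓ w →
      ℓ (if z = b then a else z) < ℓ (if w = b then a else w) := by
    intro z hz w hw hne hzw
    split_ifs with j k k
    · subst j k; omega
    · subst j; omega
    · subst k
      have hza : z ≠ a := fun hza => hne ⟨hza, rfl⟩
      have := hnab z hz hza (ne_of hzw)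
      omega
    · exact hzw
  have mc := h.mem ce; have md := h.mem df
  have me := h.mem_right ce; have mf := h.mem_right df
  have k1 := mono x hx c mc (fun k => hxa k.1) i1
  have k2 := mono c mc d md hcd i2
  have k3 := mono d md y hy (fun k => hyb k.2) i3
  have k4 := mono y hy e me (fun k => hya k.1)
  have k5 := mono e me f mf hef
  have k6 := mono f mf x hx (fun k => hxb k.2)
  have k7 := mono e me x hx (fun k => hxb k.2)
  have k8 := mono y hy f mf (fun k => hya k.1)
  rw [if_neg hxb] at k1 k6 k7
  rw [if_neg hyb] at k3 k4 k8
  have hab := ne_of h2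
  have ce' := contract_adj_of_adj hab ce (by
    intro hh
    have := congrArg ℓ hh
    omega)
  have df' := contract_adj_of_adj hab df (by
    intro hh
    have := congrArg ℓ hh
    omega)
  refine ⟨_, _, _, _, ce', df', ?_, ?_, ?_⟩ <;> unfold Crosses Interleave <;> omega

/-- Saturation of the contraction at the pairs that contain the contracted vertex. -/
theorem sat_contract_left [DecidableEq V] (h : IsTwoTriangulation ℓ S G) {u a b v s : V}
    (he : IsEar ℓ S G u a b v) (hs : ℓ v < ℓ s) (has : G.Adj a s) (hbs : G.Adj b s)
    {y : V} (hy : y ∈ S) (hya : y ≠ a) (hyb : y ≠ b) (hn : ¬ (contract G a b).Adj a y) :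
    ∃ p q r s, (contract G a b).Adj p q ∧ (contract G a b).Adj r s ∧
      Crosses ℓ a y p q ∧ Crosses ℓ a y r s ∧ Crosses ℓ p q r s := by
  have h1 := he.ua; have h2 := he.ab; have h3 := he.bv
  have ne_of : ∀ {x y : V}, ℓ x < ℓ y → x ≠ y := by rintro x y hxy rfl; omega
  have hab := ne_of h2
  have hn1 : ¬ G.Adj a y := fun k => hn ⟨hya.symm, hab, hyb, Or.inl k⟩
  have hn2 : ¬ G.Adj b y := fun k => hn ⟨hya.symm, hab, hyb, Or.inr (Or.inl ⟨rfl, k⟩)⟩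
  obtain ⟨-, au, bu, av, bv⟩ := h.adj_inner he
  have hvy : ℓ v < ℓ y := by
    rcases he.rest y hy with rfl | rfl | rfl | rfl | hz' <;> first | assumption | contradiction
  have hu : ∀ z ∈ S, ℓ z < ℓ a → z = u := by
    intro z hz hza
    rcases he.rest z hz with rfl | rfl | rfl | rfl | hz' <;> first | rfl | omega
  have keep : ∀ {c e}, G.Adj c e → c ≠ b → e ≠ b → (contract G a b).Adj c e :=
    fun k k1 k2 => ⟨k.ne, k1, k2, Or.inl k⟩
  have hys : ℓ y ≠ ℓ s := fun k => hn1 (h.inj k ▸ has)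
  rcases lt_or_gt_of_ne hys with hlt | hlt
  · obtain ⟨c, d, e, f, ce, df, i1, i2, i3, i4⟩ :=
      h.exists_of_not_adj he.mem_b hy (by omega) hn2
    have hvd : ℓ v < ℓ d := by
      rcases he.rest c (h.mem ce) with rfl | rfl | rfl | rfl | hz' <;> omega
    have hfa : f ≠ a := by
      rintro rfl
      have := h.le_of_adj_of_adj he df.symm hbs hvd hs
      omega
    have hf : ℓ f < ℓ b → f = u := by
      intro hfb
      rcases he.rest f (h.mem_right df) with rfl | rfl | rfl | rfl | hz' <;>
        first | rfl | omega | contradiction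
    have hey : ℓ y < ℓ e := by
      rcases i4 with i4 | i4 | i4
      · omega
      · omega
      · have := hf i4.2
        subst this
        rcases he.rest e (h.mem_right ce) with rfl | rfl | rfl | rfl | hz' <;> omega
    have hff : ℓ e < ℓ f ∨ ℓ f < ℓ a := by
      rcases i4 with i4 | i4 | i4
      · omega
      · have := hf i4.2
        subst this
        omega
      · omega
    refine ⟨c, e, d, f, keep ce (ne_of i1).symm (ne_of (by omega)).symm,
      keep df (ne_of (by omega)).symm ?_, ?_, ?_, ?_⟩
    · rintro rfl; omega
    all_goals unfold Crosses Interleave; omega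
  · obtain ⟨c, d, e, f, ce, df, i1, i2, i3, i4⟩ :=
      h.exists_of_not_adj he.mem_a hy (by omega) hn1
    have hey : ℓ y < ℓ e := by
      rcases i4 with i4 | i4 | i4
      · omega
      · omega
      · have := hu e (h.mem_right ce) (by omega)
        have := hu f (h.mem_right df) (by omega)
        subst e f
        omega
    have hcb : c ≠ b := by
      rintro rfl
      have := h.le_of_adj_of_adj he has ce hs (by omega)
      omega
    have hdb : d ≠ b := by
      rintro rfl
      rcases he.rest c (h.mem ce) with rfl | rfl | rfl | rfl | hz' <;> omega
    refine ⟨c, e, d, f, keep ce hcb (ne_of (by omega)).symm,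
      keep df hdb ?_, ?_, ?_, ?_⟩
    · rintro rfl; omega
    all_goals unfold Crosses Interleave; omega

theorem contract_isTwoTriangulation [DecidableEq V] (h : IsTwoTriangulation ℓ S G) {u a b v s : V}
    (he : IsEar ℓ S G u a b v) (hs : ℓ v < ℓ s) (has : G.Adj a s) (hbs : G.Adj b s) :
    IsTwoTriangulation ℓ (S.erase b) (contract G a b) := by
  have hcomm : ∀ p q r s, Crosses ℓ p q r s → Crosses ℓ q p r s := by
    intro p q r s; unfold Crosses Interleave; omega
  refine ⟨h.inj, ?_, h.free_contract he, ?_⟩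
  · rintro x y ⟨-, hx, -, k | ⟨rfl, k⟩ | ⟨rfl, k⟩⟩
    · exact Finset.mem_erase.2 ⟨hx, h.mem k⟩
    · exact Finset.mem_erase.2 ⟨hx, he.mem_a⟩
    · exact Finset.mem_erase.2 ⟨hx, h.mem k⟩
  · intro x hx y hy hxy hn
    rw [Finset.mem_erase] at hx hy
    by_cases hxa : x = a
    · subst hxa
      exact h.sat_contract_left he hs has hbs hy.2 hxy.symm hy.1 hn
    by_cases hya : y = a
    · subst hya
      obtain ⟨p, q, r, t, k1, k2, k3, k4, k5⟩ :=
        h.sat_contract_left he hs has hbs hx.2 hxy hx.1 (fun k => hn k.symm)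
      exact ⟨p, q, r, t, k1, k2, hcomm _ _ _ _ k3, hcomm _ _ _ _ k4, k5⟩
    have hn' : ¬ G.Adj x y := fun k => hn ⟨hxy, hx.1, hy.1, Or.inl k⟩
    have := h.inj.ne hxy
    rcases lt_or_gt_of_ne this with hlt | hlt
    · exact h.sat_contract_of_ne he hx.2 hy.2 hxa hx.1 hya hy.1 hlt hn'
    · obtain ⟨p, q, r, t, k1, k2, k3, k4, k5⟩ :=
        h.sat_contract_of_ne he hy.2 hx.2 hya hy.1 hxa hx.1 hlt (fun k => hn' k.symm)
      exact ⟨p, q, r, t, k1, k2, hcomm _ _ _ _ k3, hcomm _ _ _ _ k4, k5⟩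

/-- A two-triangulation with at least six vertices is a vertex split of a smaller one: some edge
`a b` lies in exactly three triangles, and its contraction is again a two-triangulation. -/
theorem exists_contract [Finite V] [DecidableEq V] (h : IsTwoTriangulation ℓ S G)
    (hS : 6 ≤ S.card) : ∃ (ℓ' : V → ℕ) (a b : V) (c : Fin 3 → V), b ∈ S ∧ G.Adj a b ∧
      Function.Injective c ∧ (∀ i, G.Adj a (c i) ∧ G.Adj b (c i)) ∧
      (∀ z, G.Adj a z → G.Adj b z → ∃ i, z = c i) ∧
      IsTwoTriangulation ℓ' (S.erase b) (contract G a b) := by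
  obtain ⟨ℓ', u, a, b, v, h', he⟩ := h.exists_isEar (by omega)
  obtain ⟨s, hs, has, hbs⟩ := h'.exists_common (by omega) he
  obtain ⟨ab, au, bu, av, bv⟩ := h'.adj_inner he
  have h1 := he.ua; have h2 := he.ab; have h3 := he.bv
  have ne_of : ∀ {x y : V}, ℓ' x < ℓ' y → x ≠ y := by rintro x y hxy rfl; omega
  refine ⟨ℓ', a, b, ![u, v, s], he.mem_b, ab, ?_, ?_, ?_,
    h'.contract_isTwoTriangulation he hs has hbs⟩
  · have n1 : u ≠ v := ne_of (by omega)
    have n2 : u ≠ s := ne_of (by omega)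
    have n3 : v ≠ s := ne_of (by omega)
    intro i j hij
    fin_cases i <;> fin_cases j <;> simp_all
  · intro i
    fin_cases i
    exacts [⟨au, bu⟩, ⟨av, bv⟩, ⟨has, hbs⟩]
  · intro z haz hbz
    rcases he.rest z (h'.mem_right haz) with rfl | rfl | rfl | rfl | hz
    · exact ⟨0, rfl⟩
    · exact absurd haz (G.irrefl)
    · exact absurd hbz (G.irrefl)
    · exact ⟨1, rfl⟩
    · refine ⟨2, h'.inj (le_antisymm ?_ ?_)⟩
      · exact h'.le_of_adj_of_adj he has hbz hs hz
      · exact h'.le_of_adj_of_adj he haz hbs hz hs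

end IsTwoTriangulation

/-! ### Independence of the edge lengths -/

/-- For an antisymmetric assignment `D` of edge directions in `ℝ ^ d`, the rows of the rigidity
matrix of `G` are linearly independent. This is expressed dually: the first-order changes of the
edge lengths can be prescribed arbitrarily. -/
def EdgesIndependent {V : Type*} {d : ℕ} (G : SimpleGraph V) (D : V → V → Fin d → ℝ) : Prop :=
  ∀ y : Sym2 V → ℝ, ∃ m : V → Fin d → ℝ, ∀ u v, G.Adj u v →
    ∑ i, D u v i * (m u i - m v i) = y s(u, v)

/-- The edge directions of a framework. -/
def edgeDir {V R : Type*} {d : ℕ} [Sub R] (p : V → Fin d → R) (u v : V) (i : Fin d) : R :=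
  p u i - p v i

/-- The rigidity matrix, with a row for each edge, oriented by `Quot.out`. -/
noncomputable def rigidityMatrix {V R : Type*} {d : ℕ} [DecidableEq V] [CommRing R]
    (G : SimpleGraph V) (D : V → V → Fin d → R) : Matrix G.edgeSet (V × Fin d) R :=
  Matrix.of fun e w => ((if w.1 = (Quot.out e.1).1 then 1 else 0) -
    (if w.1 = (Quot.out e.1).2 then 1 else 0)) * D (Quot.out e.1).1 (Quot.out e.1).2 w.2

theorem mulVec_surjective_iff_det_ne_zero {m n : Type*} [Fintype m] [DecidableEq m] [Fintype n]
    (A : Matrix m n ℝ) : Function.Surjective A.mulVec ↔ (A * A.transpose).det ≠ 0 := by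
  constructor
  · intro h hdet
    obtain ⟨v, hv, hv0⟩ := Matrix.exists_mulVec_eq_zero_iff.2 hdet
    obtain ⟨w, rfl⟩ := h v
    have h1 : A.transpose.mulVec (A.mulVec w) = 0 := by
      rw [← dotProduct_self_eq_zero]
      rw [← Matrix.mulVec_mulVec] at hv0
      have := congrArg (fun z => A.mulVec w ⬝ᵥ z) hv0
      simp only [dotProduct_zero] at this
      rw [Matrix.dotProduct_mulVec, ← Matrix.mulVec_transpose] at this
      exact this
    apply hv
    rw [← dotProduct_self_eq_zero, Matrix.dotProduct_mulVec, ← Matrix.mulVec_transpose, h1,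
      zero_dotProduct]
  · intro h y
    refine ⟨A.transpose.mulVec ((A * A.transpose)⁻¹.mulVec y), ?_⟩
    rw [Matrix.mulVec_mulVec, Matrix.mulVec_mulVec, Matrix.mul_nonsing_inv _ h.isUnit,
      Matrix.one_mulVec]

section

variable {V : Type*} {d : ℕ} {G : SimpleGraph V}

theorem EdgesIndependent.mono {H : SimpleGraph V} {D : V → V → Fin d → ℝ} (hH : H ≤ G)
    (h : EdgesIndependent G D) : EdgesIndependent H D := fun y =>
  (h y).imp fun _ hm u v huv => hm u v (hH huv)

theorem EdgesIndependent.scale {D : V → V → Fin d → ℝ} {k : Sym2 V → ℝ} (hk : ∀ e, k e ≠ 0)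
    (h : EdgesIndependent G D) : EdgesIndependent G fun u v i => k s(u, v) * D u v i := by
  intro y
  obtain ⟨m, hm⟩ := h fun e => y e / k e
  refine ⟨m, fun u v huv => ?_⟩
  simp only [mul_assoc, ← Finset.mul_sum]
  rw [hm u v huv, mul_div_cancel₀ _ (hk _)]

theorem rigidityMatrix_mulVec [Fintype V] [DecidableEq V] (D : V → V → Fin d → ℝ)
    (m : V → Fin d → ℝ) (e : G.edgeSet) :
    (rigidityMatrix G D).mulVec (fun w => m w.1 w.2) e =
      ∑ i, D (Quot.out e.1).1 (Quot.out e.1).2 i *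
        (m (Quot.out e.1).1 i - m (Quot.out e.1).2 i) := by
  simp only [rigidityMatrix, Matrix.mulVec, dotProduct, Matrix.of_apply, Fintype.sum_prod_type]
  rw [Finset.sum_comm]
  refine Finset.sum_congr rfl fun i _ => ?_
  simp only [sub_mul, ite_mul, one_mul, zero_mul, Finset.sum_sub_distrib, Finset.sum_ite_eq',
    Finset.mem_univ, if_true, mul_sub]

theorem edgesIndependent_iff_surjective [Fintype V] [DecidableEq V] {D : V → V → Fin d → ℝ}
    (hD : ∀ u v i, D v u i = -D u v i) :
    EdgesIndependent G D ↔ Function.Surjective (rigidityMatrix G D).mulVec := by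
  classical
  constructor
  · intro h y
    obtain ⟨m, hm⟩ := h fun e => if he : e ∈ G.edgeSet then y ⟨e, he⟩ else 0
    refine ⟨fun w => m w.1 w.2, funext fun e => ?_⟩
    have he : s((Quot.out e.1).1, (Quot.out e.1).2) = e.1 := Quot.out_eq e.1
    have hadj : G.Adj (Quot.out e.1).1 (Quot.out e.1).2 := by
      rw [← SimpleGraph.mem_edgeSet, he]
      exact e.2
    rw [rigidityMatrix_mulVec, hm _ _ hadj, he, dif_pos e.2]
  · intro h y
    obtain ⟨w, hw⟩ := h fun e => y e.1
    refine ⟨fun v i => w (v, i), fun u v huv => ?_⟩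
    have h1 := congrFun hw ⟨s(u, v), huv⟩
    have h2 := rigidityMatrix_mulVec D (fun v i => w (v, i)) ⟨s(u, v), huv⟩
    simp only [Prod.mk.eta] at h1 h2
    have he : s((Quot.out s(u, v)).1, (Quot.out s(u, v)).2) = s(u, v) := Quot.out_eq _
    rw [h1] at h2
    rw [h2]
    rcases Sym2.eq_iff.1 he with ⟨e1, e2⟩ | ⟨e1, e2⟩
    · rw [e1, e2]
    · rw [e1, e2]
      refine Finset.sum_congr rfl fun i _ => ?_
      rw [hD u v]
      ring

theorem edgesIndependent_iff_det [Fintype V] [DecidableEq V] [Fintype G.edgeSet]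
    {D : V → V → Fin d → ℝ} (hD : ∀ u v i, D v u i = -D u v i) :
    EdgesIndependent G D ↔ (rigidityMatrix G D * (rigidityMatrix G D).transpose).det ≠ 0 := by
  classical
  rw [edgesIndependent_iff_surjective hD, mulVec_surjective_iff_det_ne_zero]

theorem edgeDir_antisymm (p : V → Fin d → ℝ) (u v : V) (i : Fin d) :
    edgeDir p v u i = -edgeDir p u v i := by
  simp [edgeDir]

/-- Independence is an open condition on the edge directions. -/
theorem EdgesIndependent.exists_ne_zero [Finite V] {D : ℝ → V → V → Fin d → ℝ}
    (hD : ∀ ε u v i, D ε v u i = -D ε u v i) (hc : ∀ u v i, Continuous fun ε => D ε u v i)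
    (h : EdgesIndependent G (D 0)) : ∃ ε ≠ 0, EdgesIndependent G (D ε) := by
  classical
  cases nonempty_fintype V
  rw [edgesIndependent_iff_det (hD 0)] at h
  have hcont : Continuous fun ε =>
      (rigidityMatrix G (D ε) * (rigidityMatrix G (D ε)).transpose).det := by
    have hM : Continuous fun ε => rigidityMatrix G (D ε) := by
      refine continuous_matrix fun e w => ?_
      simp only [rigidityMatrix, Matrix.of_apply]
      exact continuous_const.mul (hc _ _ _)
    exact (hM.matrix_mul hM.matrix_transpose).matrix_det
  have hev := hcont.continuousAt.eventually_ne h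
  have hev' : ∀ᶠ ε in nhdsWithin (0 : ℝ) {0}ᶜ, _ := hev.filter_mono nhdsWithin_le_nhds
  obtain ⟨ε, h1, h2⟩ := (hev'.and self_mem_nhdsWithin).exists
  exact ⟨ε, h2, (edgesIndependent_iff_det (hD ε)).2 h1⟩

/-- The rigidity matrix of a framework whose coordinates are indeterminates. -/
noncomputable def genericRigidityMatrix [DecidableEq V] (d : ℕ) (G : SimpleGraph V) :
    Matrix G.edgeSet (V × Fin d) (MvPolynomial (V × Fin d) ℚ) :=
  rigidityMatrix G (edgeDir fun v i => MvPolynomial.X (v, i))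

/-- The Gram determinant of the generic rigidity matrix. -/
noncomputable def gramPoly [Fintype V] (d : ℕ) (G : SimpleGraph V) :
    MvPolynomial (V × Fin d) ℚ := by
  classical
  exact (genericRigidityMatrix d G * (genericRigidityMatrix d G).transpose).det

theorem aeval_gramPoly_ne_zero_iff [Fintype V] (p : V → Fin d → ℝ) :
    MvPolynomial.aeval (fun w : V × Fin d => p w.1 w.2) (gramPoly d G) ≠ 0 ↔
      EdgesIndependent G (edgeDir p) := by
  classical
  rw [edgesIndependent_iff_det (edgeDir_antisymm p), gramPoly, AlgHom.map_det,
    AlgHom.mapMatrix_apply, Matrix.map_mul, Matrix.transpose_map]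
  have : (genericRigidityMatrix d G).map (MvPolynomial.aeval fun w : V × Fin d => p w.1 w.2) =
      rigidityMatrix G (edgeDir p) := by
    ext e w
    simp only [genericRigidityMatrix, rigidityMatrix, edgeDir, Matrix.map_apply, Matrix.of_apply,
      map_mul, map_sub, MvPolynomial.aeval_X]
    congr 1
    split_ifs <;> simp
  rw [this]

theorem gramPoly_ne_zero [Fintype V] {p : V → Fin d → ℝ} (h : EdgesIndependent G (edgeDir p)) :
    gramPoly d G ≠ 0 := by
  intro h0
  exact (aeval_gramPoly_ne_zero_iff p).2 h (by rw [h0, map_zero])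

/-- A nonzero rational polynomial does not vanish at all real points. -/
theorem exists_aeval_ne_zero {σ : Type*} {Q : MvPolynomial σ ℚ} (hQ : Q ≠ 0) :
    ∃ p : σ → ℝ, MvPolynomial.aeval p Q ≠ 0 := by
  by_contra! hc
  apply hQ
  apply MvPolynomial.funext
  intro x
  have := hc (algebraMap ℚ ℝ ∘ x)
  rw [MvPolynomial.aeval_algebraMap_apply] at this
  simpa using this

/-! ### Vertex splitting -/

/-- The complete graph on the vertices of a simplex has independent edges. -/
theorem exists_edgesIndependent_of_card (S : Finset V) (hS : S.card = d + 1)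
    (hG : ∀ u v, G.Adj u v → u ∈ S) : ∃ p : V → Fin d → ℝ, EdgesIndependent G (edgeDir p) := by
  classical
  let g := S.equivFinOfCardEq hS
  let idx : V → Fin (d + 1) := fun x => if hx : x ∈ S then g ⟨x, hx⟩ else 0
  let P : Fin (d + 1) → Fin d → ℝ := Fin.cons 0 fun i => Pi.single i 1
  refine ⟨fun x => P (idx x), fun y => ?_⟩
  let Y : Fin (d + 1) → Fin (d + 1) → ℝ :=
    fun k l => if k = l then 0 else y s((g.symm k).1, (g.symm l).1)
  have hY : ∀ k l, Y k l = Y l k := by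
    intro k l
    simp only [Y, eq_comm (a := k), Sym2.eq_swap (a := (g.symm k).1)]
  have hY0 : ∀ k, Y k k = 0 := by simp [Y]
  -- the polarization of `Y` at the vertex at the origin
  let m : Fin (d + 1) → Fin d → ℝ :=
    Fin.cons 0 fun i j => (Y 0 i.succ + Y 0 j.succ - Y i.succ j.succ) / 2
  have key : ∀ k l, ∑ i, (P k i - P l i) * (m k i - m l i) = Y k l := by
    intro k l
    refine Fin.cases ?_ (fun k => ?_) k <;> refine Fin.cases ?_ (fun l => ?_) l
    · simp [P, m, hY0]
    · simp [P, m, Pi.single_apply, hY0]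
    · simp [P, m, Pi.single_apply, hY0, hY k.succ 0]
    · simp [P, m, Pi.single_apply, sub_mul, Finset.sum_sub_distrib, hY0, hY l.succ k.succ]
      ring
  refine ⟨fun x => m (idx x), fun u v huv => ?_⟩
  have hu := hG u v huv
  have hv := hG v u huv.symm
  simp only [edgeDir]
  rw [key]
  have hne : g ⟨u, hu⟩ ≠ g ⟨v, hv⟩ := by
    rw [g.injective.ne_iff]
    simpa using huv.ne
  simp [Y, idx, hu, hv, hne]

/-- In the degenerate position where the two vertices `a` and `b` of an edge coincide and the edge
has the direction `z`, a graph has independent edges if its contraction has, and if `z` and the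
directions to the common neighbours of `a` and `b` form a basis. -/
theorem edgesIndependent_degenerate {a b : V} {c : Fin d → V} (hab : G.Adj a b)
    (hcommon : ∀ z, G.Adj a z → G.Adj b z → ∃ i, z = c i)
    {p : V → Fin (d + 1) → ℝ} (hG : EdgesIndependent (contract G a b) (edgeDir p))
    {z : Fin (d + 1) → ℝ}
    (hdet : (Matrix.of (Fin.cons z fun i => edgeDir p a (c i)) :
      Matrix (Fin (d + 1)) (Fin (d + 1)) ℝ).det ≠ 0)
    {D : V → V → Fin (d + 1) → ℝ} (hD : ∀ u v i, D v u i = -D u v i) (hDba : D b a = z)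
    (hDb : ∀ v, v ≠ a → v ≠ b → D b v = edgeDir p a v)
    (hDuv : ∀ u v, u ≠ b → v ≠ b → D u v = edgeDir p u v) : EdgesIndependent G D := by
  classical
  intro y
  -- the velocity of `b` relative to `a`
  obtain ⟨δ, hδ⟩ : ∃ δ : Fin (d + 1) → ℝ, (Matrix.of (Fin.cons z fun i => edgeDir p a (c i)) :
      Matrix (Fin (d + 1)) (Fin (d + 1)) ℝ).mulVec δ =
        Fin.cons (y s(a, b)) fun i => y s(b, c i) - y s(a, c i) :=
    ⟨(Matrix.of (Fin.cons z fun i => edgeDir p a (c i)))⁻¹.mulVec _, by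
      rw [Matrix.mulVec_mulVec, Matrix.mul_nonsing_inv _ hdet.isUnit, Matrix.one_mulVec]⟩
  have hδ0 : ∑ i, z i * δ i = y s(a, b) := by
    simpa [Matrix.mulVec, dotProduct] using congrFun hδ 0
  have hδc : ∀ k, ∑ i, edgeDir p a (c k) i * δ i = y s(b, c k) - y s(a, c k) := by
    intro k
    simpa [Matrix.mulVec, dotProduct] using congrFun hδ k.succ
  let y' : Sym2 V → ℝ := fun e => if e ∈ G.edgeSet then y e else
    if h : ∃ x, e = s(a, x) then
      y s(b, h.choose) - ∑ i, edgeDir p a h.choose i * δ i else 0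
  have hy1 : ∀ u v, G.Adj u v → y' s(u, v) = y s(u, v) := by
    intro u v huv
    simp [y', huv]
  have hy2 : ∀ x, ¬ G.Adj a x → y' s(a, x) = y s(b, x) - ∑ i, edgeDir p a x i * δ i := by
    intro x hx
    have hex : ∃ x', s(a, x) = s(a, x') := ⟨x, rfl⟩
    have hch : hex.choose = x := (Sym2.congr_right.1 hex.choose_spec).symm
    simp only [y', SimpleGraph.mem_edgeSet, hx, if_false]
    rw [dif_pos hex, hch]
  obtain ⟨m, hm⟩ := hG y'
  refine ⟨fun x => if x = b then m a + δ else m x, ?_⟩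
  have main : ∀ v, G.Adj b v → ∑ i, D b v i * ((if b = b then m a + δ else m b) i -
      (if v = b then m a + δ else m v) i) = y s(b, v) := by
    intro v hbv
    rw [if_pos rfl, if_neg hbv.ne']
    by_cases hva : v = a
    · subst hva
      simp only [hDba, Pi.add_apply, add_sub_cancel_left, hδ0]
      rw [Sym2.eq_swap]
    rw [hDb v hva hbv.ne']
    have hadj : (contract G a b).Adj a v :=
      ⟨Ne.symm hva, hab.ne, hbv.ne', Or.inr (Or.inl ⟨rfl, hbv⟩)⟩
    have hmv := hm a v hadj
    have hsum : ∑ i, edgeDir p a v i * ((m a + δ) i - m v i) =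
        ∑ i, edgeDir p a v i * (m a i - m v i) + ∑ i, edgeDir p a v i * δ i := by
      rw [← Finset.sum_add_distrib]
      refine Finset.sum_congr rfl fun i _ => ?_
      simp only [Pi.add_apply]
      ring
    rw [hsum, hmv]
    by_cases hav : G.Adj a v
    · obtain ⟨k, rfl⟩ := hcommon v hav hbv
      rw [hy1 _ _ hav, hδc]
      ring
    · rw [hy2 v hav]
      ring
  intro u v huv
  by_cases hu : u = b
  · subst hu
    exact main v huv
  by_cases hv : v = b
  · subst hv
    rw [Sym2.eq_swap, ← main u huv.symm]
    refine Finset.sum_congr rfl fun i _ => ?_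
    rw [hD v u]
    ring
  · dsimp only
    rw [if_neg hu, if_neg hv, hDuv u v hu hv, hm u v ⟨huv.ne, hu, hv, Or.inl huv⟩, hy1 u v huv]

/-- Whiteley's vertex splitting: if the contraction of an edge `a b` in `d + 1` dimensions with
exactly `d` common neighbours has independent edges in some position, so has the graph. -/
theorem exists_edgesIndependent_of_contract [Finite V] {a b : V} {c : Fin d → V}
    (hab : G.Adj a b) (hc : ∀ i, G.Adj a (c i) ∧ G.Adj b (c i)) (hcinj : Function.Injective c)
    (hcommon : ∀ z, G.Adj a z → G.Adj b z → ∃ i, z = c i)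
    (hG : ∃ p : V → Fin (d + 1) → ℝ, EdgesIndependent (contract G a b) (edgeDir p)) :
    ∃ p : V → Fin (d + 1) → ℝ, EdgesIndependent G (edgeDir p) := by
  classical
  cases nonempty_fintype V
  obtain ⟨p₀, hp₀⟩ := hG
  let z : Fin (d + 1) → ℝ := Pi.single 0 1
  let N : Matrix (Fin (d + 1)) (Fin (d + 1)) (MvPolynomial (V × Fin (d + 1)) ℚ) :=
    Matrix.of (Fin.cons (Pi.single 0 1) fun i => edgeDir (fun v j => MvPolynomial.X (v, j)) a (c i))
  have hN : ∀ p : V → Fin (d + 1) → ℝ, MvPolynomial.aeval (fun w => p w.1 w.2) N.det =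
      (Matrix.of (Fin.cons z fun i => edgeDir p a (c i)) :
        Matrix (Fin (d + 1)) (Fin (d + 1)) ℝ).det := by
    intro p
    rw [AlgHom.map_det]
    congr 1
    ext k j
    refine Fin.cases ?_ (fun k => ?_) k
    · by_cases hj : j = 0
      · subst hj; simp [N, z]
      · simp [N, z, hj]
    · simp [N, edgeDir]
  have hN0 : N.det ≠ 0 := by
    intro h0
    -- place `a` at the origin and the common neighbours at the negative basis vectors
    let q : V → Fin (d + 1) → ℝ := fun x j => if ∃ k : Fin d, x = c k ∧ j = k.succ then -1 else 0
    have h1 := hN q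
    rw [h0, map_zero] at h1
    have hone : (Matrix.of (Fin.cons z fun i => edgeDir q a (c i)) :
        Matrix (Fin (d + 1)) (Fin (d + 1)) ℝ) = 1 := by
      ext k j
      refine Fin.cases ?_ (fun k => ?_) k
      · simp [z, Matrix.one_apply, Pi.single_apply, eq_comm]
      · have hak : ∀ k, a ≠ c k := fun k => (hc k).1.ne
        simp [q, edgeDir, hak, hcinj.eq_iff, Matrix.one_apply, eq_comm]
        split_ifs <;> simp
    rw [hone, Matrix.det_one] at h1
    exact zero_ne_one h1
  obtain ⟨p', hp'⟩ := exists_aeval_ne_zero (mul_ne_zero (gramPoly_ne_zero hp₀) hN0)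
  let p : V → Fin (d + 1) → ℝ := fun v i => p' (v, i)
  rw [map_mul] at hp'
  have hp1 : EdgesIndependent (contract G a b) (edgeDir p) :=
    (aeval_gramPoly_ne_zero_iff p).1 (left_ne_zero_of_mul hp')
  have hp2 := right_ne_zero_of_mul hp'
  have hp3 := hN p
  rw [show (fun w : V × Fin (d + 1) => p w.1 w.2) = p' from rfl] at hp3
  rw [hp3] at hp2
  let q : ℝ → V → Fin (d + 1) → ℝ := fun ε x i => if x = b then p a i + ε * z i else p x i
  let D : ℝ → V → V → Fin (d + 1) → ℝ := fun ε u v =>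
    if u = a ∧ v = b then -z else if u = b ∧ v = a then z else edgeDir (q ε) u v
  have hne := hab.ne
  have hD : ∀ ε u v i, D ε v u i = -D ε u v i := by
    intro ε u v i
    by_cases h1 : u = a ∧ v = b
    · obtain ⟨rfl, rfl⟩ := h1
      simp [D, hne.symm]
    by_cases h2 : u = b ∧ v = a
    · obtain ⟨rfl, rfl⟩ := h2
      simp [D, hne.symm]
    · simp only [D]
      rw [if_neg (by tauto), if_neg (by tauto), if_neg h1, if_neg h2, edgeDir_antisymm]
  have h0 : EdgesIndependent G (D 0) := by
    refine edgesIndependent_degenerate hab hcommon hp1 hp2 (hD 0) ?_ ?_ ?_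
    · simp [D, hne.symm]
    · intro v hva hvb
      ext i
      simp [D, hne.symm, hva, hvb, edgeDir, q]
    · intro u v hub hvb
      ext i
      simp [D, hub, hvb, edgeDir, q]
  obtain ⟨ε, hε, hind⟩ := EdgesIndependent.exists_ne_zero hD (by
    intro u v i
    by_cases h1 : u = a ∧ v = b
    · simp only [D, if_pos h1]
      exact continuous_const
    by_cases h2 : u = b ∧ v = a
    · simp only [D, if_neg h1, if_pos h2]
      exact continuous_const
    · simp only [D, if_neg h1, if_neg h2, edgeDir, q]
      split_ifs <;> fun_prop) h0
  refine ⟨q ε, ?_⟩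
  have hs := hind.scale (k := fun e => if e = s(a, b) then ε else 1)
    (by intro e; split_ifs <;> simp [hε])
  convert hs using 1
  ext u v i
  by_cases h1 : u = a ∧ v = b
  · obtain ⟨rfl, rfl⟩ := h1
    simp [D, edgeDir, q, hne]
  by_cases h2 : u = b ∧ v = a
  · obtain ⟨rfl, rfl⟩ := h2
    simp [D, edgeDir, q, hne, Sym2.eq_swap]
  · have : s(u, v) ≠ s(a, b) := by
      rw [Ne, Sym2.eq_iff]
      tauto
    simp only [D, if_neg h1, if_neg h2, if_neg this, one_mul]

/-- Contracting an edge that lies in at least `d` triangles removes at least `d + 1` edges. -/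
theorem ncard_contract_le [Finite V] {a b : V} {c : Fin d → V} (hab : G.Adj a b)
    (hc : ∀ i, G.Adj a (c i) ∧ G.Adj b (c i)) (hcinj : Function.Injective c) :
    (contract G a b).edgeSet.ncard + (d + 1) ≤ G.edgeSet.ncard := by
  classical
  let K : Set (Sym2 V) := insert s(a, b) (Set.range fun i => s(b, c i))
  have hinj : Function.Injective fun i => s(b, c i) := fun i j hij =>
    hcinj (Sym2.congr_right.1 hij)
  have hnot : s(a, b) ∉ Set.range fun i => s(b, c i) := by
    rintro ⟨i, hi⟩
    rw [Sym2.eq_swap (a := a), Sym2.congr_right] at hi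
    exact (hc i).1.ne hi.symm
  have hK : K.ncard = d + 1 := by
    rw [Set.ncard_insert_of_notMem hnot (Set.toFinite _), ← Set.image_univ,
      Set.ncard_image_of_injective _ hinj, Set.ncard_univ, Nat.card_fin]
  have hKG : K ⊆ G.edgeSet := by
    rintro e (rfl | ⟨i, rfl⟩)
    exacts [hab, (hc i).2]
  have hsub : (contract G a b).edgeSet ⊆
      Sym2.map (fun x => if x = b then a else x) '' (G.edgeSet \ K) := by
    intro e
    induction e with
    | _ u v =>
    intro huv
    rw [SimpleGraph.mem_edgeSet] at huv
    obtain ⟨hne, hub, hvb, h⟩ := huv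
    have hab' := hab.ne
    -- an edge that avoids `b` is its own preimage
    have old : ∀ u v, u ≠ b → v ≠ b → G.Adj u v →
        s(u, v) ∈ Sym2.map (fun x => if x = b then a else x) '' (G.edgeSet \ K) := by
      intro u v hub hvb h
      refine ⟨s(u, v), ⟨h, ?_⟩, by simp [hub, hvb]⟩
      rintro (h' | ⟨i, h'⟩)
      · rcases Sym2.eq_iff.1 h' with ⟨-, h'⟩ | ⟨h', -⟩ <;> contradiction
      · rcases Sym2.eq_iff.1 h' with ⟨h', -⟩ | ⟨h', -⟩ <;> simp_all
    have new : ∀ v, v ≠ a → v ≠ b → G.Adj b v →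
        s(a, v) ∈ Sym2.map (fun x => if x = b then a else x) '' (G.edgeSet \ K) := by
      intro v hva hvb h
      by_cases hav : G.Adj a v
      · exact old a v hab' hvb hav
      refine ⟨s(b, v), ⟨h, ?_⟩, by simp [hvb]⟩
      rintro (h' | ⟨i, h'⟩)
      · rcases Sym2.eq_iff.1 h' with ⟨h', -⟩ | ⟨-, h'⟩
        · exact hab' h'.symm
        · exact hva h'
      · rw [Sym2.congr_right] at h'
        exact hav (h' ▸ (hc i).1)
    rcases h with h | ⟨rfl, h⟩ | ⟨rfl, h⟩
    · exact old u v hub hvb h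
    · exact new v hne.symm hvb h
    · rw [Sym2.eq_swap]
      exact new u hne hub h.symm
  have h1 := Set.ncard_le_ncard hsub (Set.toFinite _)
  have h2 := Set.ncard_image_le (f := Sym2.map (fun x => if x = b then a else x))
    (Set.toFinite (G.edgeSet \ K))
  have h3 := Set.ncard_sdiff_add_ncard_of_subset hKG (Set.toFinite _)
  omega

end

/-- Two-triangulations have independent edges in dimension four, and at least as many edges as a
minimally rigid graph. -/
theorem IsTwoTriangulation.exists_edgesIndependent {V : Type*} [Finite V] (k : ℕ) :
    ∀ {ℓ : V → ℕ} {S : Finset V} {G : SimpleGraph V}, IsTwoTriangulation ℓ S G →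
      S.card = k + 5 → (∃ p : V → Fin 4 → ℝ, EdgesIndependent G (edgeDir p)) ∧
        4 * S.card ≤ G.edgeSet.ncard + 10 := by
  classical
  induction k with
  | zero =>
    intro ℓ S G h hS
    refine ⟨exists_edgesIndependent_of_card S hS fun u v huv => h.mem huv, ?_⟩
    have hsub : ((S.offDiag.image Sym2.mk.uncurry : Finset (Sym2 V)) : Set (Sym2 V)) ⊆
        G.edgeSet := by
      intro e he
      simp only [Finset.coe_image, Set.mem_image, Finset.mem_coe, Finset.mem_offDiag] at he
      obtain ⟨⟨x, y⟩, ⟨hx, hy, hxy⟩, rfl⟩ := he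
      exact h.adj_of_card_le (by omega) hx hy hxy
    have h1 := Set.ncard_le_ncard hsub (Set.toFinite _)
    rw [Set.ncard_coe_finset, Sym2.card_image_offDiag, hS] at h1
    have : (0 + 5).choose 2 = 10 := rfl
    omega
  | succ k ih =>
    intro ℓ S G h hS
    obtain ⟨ℓ', a, b, c, hb, hab, hcinj, hc, hcommon, h'⟩ := h.exists_contract (by omega)
    have hcard : (S.erase b).card = k + 5 := by
      rw [Finset.card_erase_of_mem hb]
      omega
    obtain ⟨h1, h2⟩ := ih h' hcard
    refine ⟨exists_edgesIndependent_of_contract hab hc hcinj hcommon h1, ?_⟩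
    have := ncard_contract_le hab hc hcinj
    omega

/-! ### Isometries from equal distances -/

theorem exists_isometryEquiv {V E : Type*} [Finite V] [NormedAddCommGroup E]
    [InnerProductSpace ℝ E] [FiniteDimensional ℝ E] {p q : V → E}
    (h : ∀ u v, dist (q u) (q v) = dist (p u) (p v)) : ∃ φ : E ≃ᵢ E, ∀ v, q v = φ (p v) := by
  classical
  cases nonempty_fintype V
  rcases isEmpty_or_nonempty V with hV | ⟨⟨o⟩⟩
  · exact ⟨IsometryEquiv.refl E, fun v => hV.elim v⟩
  let comb : (V → E) → (V → ℝ) →ₗ[ℝ] E := fun r => Fintype.linearCombination ℝ fun v => r v - r o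
  have hcomb : ∀ r a, comb r a = ∑ v, a v • (r v - r o) := fun r a =>
    Fintype.linearCombination_apply ..
  have hinner : ∀ u v, inner ℝ (q u - q o) (q v - q o) = inner ℝ (p u - p o) (p v - p o) := by
    intro u v
    rw [real_inner_eq_norm_mul_self_add_norm_mul_self_sub_norm_sub_mul_self_div_two,
      real_inner_eq_norm_mul_self_add_norm_mul_self_sub_norm_sub_mul_self_div_two,
      sub_sub_sub_cancel_right, sub_sub_sub_cancel_right]
    simp only [← dist_eq_norm, h]
  have hnorm : ∀ a, ‖comb q a‖ = ‖comb p a‖ := by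
    intro a
    rw [← sq_eq_sq₀ (norm_nonneg _) (norm_nonneg _), ← real_inner_self_eq_norm_sq,
      ← real_inner_self_eq_norm_sq, hcomb, hcomb]
    simp only [sum_inner, inner_sum, real_inner_smul_left, real_inner_smul_right, hinner]
  obtain ⟨s, hs⟩ := LinearMap.exists_rightInverse_of_surjective (comb p).rangeRestrict
    (LinearMap.range_rangeRestrict _)
  have hs' : ∀ x, comb p (s x) = x := fun x => congrArg Subtype.val (LinearMap.congr_fun hs x)
  let L : (LinearMap.range (comb p)) →ₗᵢ[ℝ] E :=
    ⟨comb q ∘ₗ s, fun x => by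
      rw [LinearMap.comp_apply, hnorm, hs', Submodule.coe_norm]⟩
  have hL : ∀ v, L.extend (p v - p o) = q v - q o := by
    intro v
    have hv : ∀ r : V → E, comb r (Pi.single v 1) = r v - r o := by
      intro r
      simp [comb]
    have hmem : p v - p o ∈ LinearMap.range (comb p) := ⟨_, hv p⟩
    have h1 : L.extend (p v - p o) = comb q (s ⟨_, hmem⟩) := L.extend_apply ⟨_, hmem⟩
    rw [h1, ← hv q, ← sub_eq_zero, ← map_sub, ← norm_eq_zero, hnorm, map_sub, hs', hv p, sub_self,
      norm_zero]
  refine ⟨((IsometryEquiv.subRight (p o)).trans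
    (L.extend.toLinearIsometryEquiv rfl).toIsometryEquiv).trans (IsometryEquiv.addRight (q o)),
    fun v => ?_⟩
  simp [hL]

/-! ### Infinitesimal rigidity -/

section

variable {V : Type*} {d : ℕ} {G : SimpleGraph V}

/-- Every velocity assignment that preserves the lengths of the edges of `G` to first order
preserves all distances between vertices to first order. -/
def IsInfinitesimallyRigid (G : SimpleGraph V) (p : V → Fin d → ℝ) : Prop :=
  ∀ m : V → Fin d → ℝ, (∀ u v, G.Adj u v → ∑ i, edgeDir p u v i * (m u i - m v i) = 0) →
    ∀ u v, ∑ i, edgeDir p u v i * (m u i - m v i) = 0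

/-- The infinitesimal isometries of `ℝ ^ d`, evaluated at the vertices of a framework. The
off-diagonal entries of the parameter are those of a skew-symmetric matrix, the diagonal entries
are a translation vector. -/
def infinitesimalIsometry (p : V → Fin d → ℝ) :
    (Sym2 (Fin d) → ℝ) →ₗ[ℝ] (V × Fin d → ℝ) where
  toFun c w := c s(w.2, w.2) +
    ∑ j, (if w.2 < j then 1 else if j < w.2 then -1 else 0) * c s(w.2, j) * p w.1 j
  map_add' c c' := by
    ext w
    simp only [Pi.add_apply, mul_add, add_mul, Finset.sum_add_distrib]
    ring
  map_smul' a c := by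
    ext w
    simp only [Pi.smul_apply, smul_eq_mul, RingHom.id_apply, mul_add, Finset.mul_sum]
    congr 1
    exact Finset.sum_congr rfl fun j _ => by ring

theorem infinitesimalIsometry_sub (p : V → Fin d → ℝ) (c : Sym2 (Fin d) → ℝ) (u v : V)
    (i : Fin d) : infinitesimalIsometry p c (u, i) - infinitesimalIsometry p c (v, i) =
      ∑ j, edgeDir p u v j * ((if i < j then 1 else if j < i then -1 else 0) * c s(i, j)) := by
  simp only [infinitesimalIsometry, LinearMap.coe_mk, AddHom.coe_mk, add_sub_add_left_eq_sub,
    ← Finset.sum_sub_distrib, edgeDir]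
  exact Finset.sum_congr rfl fun j _ => by ring

theorem sum_edgeDir_mul_infinitesimalIsometry (p : V → Fin d → ℝ) (c : Sym2 (Fin d) → ℝ)
    (u v : V) : ∑ i, edgeDir p u v i *
      (infinitesimalIsometry p c (u, i) - infinitesimalIsometry p c (v, i)) = 0 := by
  simp only [infinitesimalIsometry_sub, Finset.mul_sum]
  -- exchanging the two summation indices changes the sign
  have h := Finset.sum_comm (s := (Finset.univ : Finset (Fin d))) (t := Finset.univ)
    (f := fun i j => edgeDir p u v i * (edgeDir p u v j *
      ((if i < j then 1 else if j < i then -1 else 0) * c s(i, j))))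
  have h' : ∀ i j : Fin d, edgeDir p u v i * (edgeDir p u v j *
      ((if i < j then 1 else if j < i then -1 else 0) * c s(i, j))) =
      -(edgeDir p u v j * (edgeDir p u v i *
      ((if j < i then 1 else if i < j then -1 else 0) * c s(j, i)))) := by
    intro i j
    rw [Sym2.eq_swap (a := j)]
    rcases lt_trichotomy i j with hlt | rfl | hlt
    · simp only [hlt, if_true, hlt.not_gt, if_false]
      ring
    · simp
    · simp only [hlt, if_true, hlt.not_gt, if_false]
      ring
  have h2 : ∀ x : ℝ, x = -x → x = 0 := fun x hx => by linarith
  apply h2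
  conv_lhs => rw [h]
  rw [← Finset.sum_neg_distrib]
  refine Finset.sum_congr rfl fun i _ => ?_
  rw [← Finset.sum_neg_distrib]
  exact Finset.sum_congr rfl fun j _ => h' j i

theorem infinitesimalIsometry_injective {p : V → Fin d → ℝ} {o : V} {g : Fin d → V}
    (hdet : (Matrix.of fun k => edgeDir p (g k) o).det ≠ 0) :
    Function.Injective (infinitesimalIsometry p) := by
  rw [injective_iff_map_eq_zero]
  intro c hc
  have hoff : ∀ i j, (if i < j then 1 else if j < i then -1 else 0) * c s(i, j) = (0 : ℝ) := by
    intro i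
    have := Matrix.eq_zero_of_mulVec_eq_zero hdet
      (v := fun j => (if i < j then 1 else if j < i then -1 else 0) * c s(i, j)) (by
        ext k
        have := infinitesimalIsometry_sub p c (g k) o i
        rw [hc] at this
        simpa [Matrix.mulVec, dotProduct] using this.symm)
    exact fun j => congrFun this j
  ext e
  induction e with
  | _ i j =>
  rcases lt_trichotomy i j with hlt | rfl | hlt
  · simpa [hlt] using hoff i j
  · have := congrFun hc (o, i)
    simp only [infinitesimalIsometry, LinearMap.coe_mk, AddHom.coe_mk, hoff, zero_mul,
      Finset.sum_const_zero, add_zero, Pi.zero_apply] at this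
    simpa using this
  · simpa [hlt, hlt.not_gt] using hoff i j

/-- An independent framework with the edge count of a minimally rigid graph is infinitesimally
rigid, if its vertices affinely span the space. -/
theorem EdgesIndependent.isInfinitesimallyRigid [Fintype V] {p : V → Fin d → ℝ}
    (h : EdgesIndependent G (edgeDir p))
    (hcard : Fintype.card V * d ≤ G.edgeSet.ncard + (d + 1).choose 2) {o : V} {g : Fin d → V}
    (hdet : (Matrix.of fun k => edgeDir p (g k) o).det ≠ 0) : IsInfinitesimallyRigid G p := by
  classical
  rw [edgesIndependent_iff_surjective (edgeDir_antisymm p)] at h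
  set A := (rigidityMatrix G (edgeDir p)).mulVecLin with hA
  have hrange : LinearMap.range A = ⊤ := LinearMap.range_eq_top.2 h
  have hrank := LinearMap.finrank_range_add_finrank_ker A
  rw [hrange, finrank_top, Module.finrank_fintype_fun_eq_card, Module.finrank_fintype_fun_eq_card,
    Fintype.card_prod, Fintype.card_fin, ← Nat.card_eq_fintype_card (α := G.edgeSet),
    Nat.card_coe_set_eq] at hrank
  have hinj := infinitesimalIsometry_injective hdet
  have hΦ := LinearMap.finrank_range_of_inj hinj
  rw [Module.finrank_fintype_fun_eq_card, Sym2.card, Fintype.card_fin] at hΦ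
  have hle : LinearMap.range (infinitesimalIsometry p) ≤ LinearMap.ker A := by
    rintro _ ⟨c, rfl⟩
    rw [LinearMap.mem_ker]
    ext e
    rw [hA, Matrix.mulVecLin_apply]
    have := rigidityMatrix_mulVec (G := G) (edgeDir p)
      (fun v i => infinitesimalIsometry p c (v, i)) e
    rw [sum_edgeDir_mul_infinitesimalIsometry] at this
    exact this
  have heq := Submodule.eq_of_le_of_finrank_le hle (by omega)
  intro m hm u v
  have hmem : (fun w : V × Fin d => m w.1 w.2) ∈ LinearMap.ker A := by
    rw [LinearMap.mem_ker]
    ext e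
    rw [hA, Matrix.mulVecLin_apply, rigidityMatrix_mulVec]
    apply hm
    rw [← SimpleGraph.mem_edgeSet]
    have he : s((Quot.out e.1).1, (Quot.out e.1).2) = e.1 := Quot.out_eq e.1
    rw [he]
    exact e.2
  rw [← heq] at hmem
  obtain ⟨c, hc⟩ := hmem
  have := sum_edgeDir_mul_infinitesimalIsometry p c u v
  rw [hc] at this
  exact this

/-! ### Rigidity -/

theorem dist_sq_eq (x y : EuclideanSpace ℝ (Fin d)) : dist x y ^ 2 = ∑ i, (x i - y i) ^ 2 := by
  rw [EuclideanSpace.dist_eq, Real.sq_sqrt (Finset.sum_nonneg fun i _ => sq_nonneg _)]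
  simp only [Real.dist_eq, sq_abs]

/-- If all frameworks near `p` are infinitesimally rigid, then `(G, p)` is rigid. The difference of
two frameworks with the same edge lengths is an infinitesimal motion of their midpoint. -/
theorem isRigid_of_eventually [Finite V] {p : V → EuclideanSpace ℝ (Fin d)}
    (h : ∀ᶠ q in nhds (fun v i => p v i), IsInfinitesimallyRigid G q) : IsRigid G p := by
  have hmid : ∀ᶠ q : V → EuclideanSpace ℝ (Fin d) in nhds p,
      IsInfinitesimallyRigid G fun v i => (p v i + q v i) / 2 := by
    have hc : Continuous fun (q : V → EuclideanSpace ℝ (Fin d)) (v : V) (i : Fin d) =>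
        (p v i + q v i) / 2 := by fun_prop
    have := hc.tendsto p
    simp only [add_self_div_two] at this
    exact this.eventually h
  have hloc : ∀ᶠ q : V → EuclideanSpace ℝ (Fin d) in nhds p,
      (∀ u v, G.Adj u v → dist (q u) (q v) = dist (p u) (p v)) →
        ∀ u v, dist (q u) (q v) = dist (p u) (p v) := by
    filter_upwards [hmid] with q hq hdist
    have key : ∀ u v, dist (q u) (q v) = dist (p u) (p v) ↔
        ∑ i, edgeDir (fun v i => (p v i + q v i) / 2) u v i *
          ((q u i - p u i) - (q v i - p v i)) = 0 := by
      intro u v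
      have hsum : ∑ i, edgeDir (fun v i => (p v i + q v i) / 2) u v i *
          ((q u i - p u i) - (q v i - p v i)) =
            (dist (q u) (q v) ^ 2 - dist (p u) (p v) ^ 2) / 2 := by
        rw [dist_sq_eq, dist_sq_eq, ← Finset.sum_sub_distrib, Finset.sum_div]
        refine Finset.sum_congr rfl fun i _ => ?_
        simp only [edgeDir]
        ring
      rw [hsum, ← sq_eq_sq₀ dist_nonneg dist_nonneg]
      constructor <;> intro hh <;> linarith
    intro u v
    rw [key]
    exact hq (fun v i => q v i - p v i) (fun u v huv => (key u v).1 (hdist u v huv)) u v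
  intro γ hγ h0 hlen t
  refine exists_isometryEquiv ?_
  let A : Set unitInterval := {t | ∀ u v, dist (γ t u) (γ t v) = dist (p u) (p v)}
  suffices hA : A = Set.univ from (hA ▸ Set.mem_univ t : t ∈ A)
  have hcv : ∀ v, Continuous fun t => γ t v := fun v => (continuous_apply v).comp hγ
  refine IsClopen.eq_univ ⟨?_, ?_⟩ ⟨0, fun u v => by rw [h0]⟩
  · simp only [A, Set.ofPred_forall]
    exact isClosed_iInter fun u => isClosed_iInter fun v =>
      isClosed_eq ((hcv u).dist (hcv v)) continuous_const
  · rw [isOpen_iff_mem_nhds]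
    intro s hs
    obtain ⟨φ, hφ⟩ := exists_isometryEquiv (p := p) (q := γ s) hs
    have hc : Continuous fun t v => φ.symm (γ t v) :=
      continuous_pi fun v => φ.symm.continuous.comp (hcv v)
    have ht := hc.tendsto s
    have hps : (fun v => φ.symm (γ s v)) = p := by
      ext1 v
      rw [hφ, IsometryEquiv.symm_apply_apply]
    rw [hps] at ht
    filter_upwards [ht.eventually hloc] with t ht'
    intro u v
    have := ht' (fun u v huv => by rw [φ.symm.dist_eq]; exact hlen t u v huv) u v
    rwa [φ.symm.dist_eq] at this

/-- If the edges of `G` are independent, the length of a single edge can be changed by a movement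
that keeps the lengths of all the other edges. -/
theorem EdgesIndependent.exists_movement [Finite V] {p : V → EuclideanSpace ℝ (Fin d)}
    (h : EdgesIndependent G (edgeDir fun v i => p v i)) {a b : V} (hab : G.Adj a b) :
    ∃ γ : unitInterval → V → EuclideanSpace ℝ (Fin d), Continuous γ ∧ γ 0 = p ∧
      (∀ t u v, G.Adj u v → s(u, v) ≠ s(a, b) → dist (γ t u) (γ t v) = dist (p u) (p v)) ∧
      dist (γ 1 a) (γ 1 b) ≠ dist (p a) (p b) := by
  classical
  cases nonempty_fintype V
  obtain ⟨B, hB⟩ := LinearMap.exists_rightInverse_of_surjective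
    (rigidityMatrix G (edgeDir fun v i => p v i)).mulVecLin
    (LinearMap.range_eq_top.2 ((edgesIndependent_iff_surjective (edgeDir_antisymm _)).1 h))
  -- the framework obtained from `p` by the displacement with first-order length changes `y`
  let P : (G.edgeSet → ℝ) → V → EuclideanSpace ℝ (Fin d) :=
    fun y v => WithLp.toLp 2 fun i => p v i + B y (v, i)
  have hBc : Continuous B := B.continuous_of_finiteDimensional
  have hPc : Continuous P := by
    refine continuous_pi fun v => ?_
    exact (PiLp.continuous_toLp 2 _).comp (continuous_pi fun i =>
      continuous_const.add ((continuous_apply (v, i)).comp hBc))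
  have hP0 : P 0 = p := by
    ext v i
    simp [P]
  let f : (G.edgeSet → ℝ) → G.edgeSet → ℝ := fun y e =>
    dist (P y (Quot.out e.1).1) (P y (Quot.out e.1).2) ^ 2 / 2
  let ψ : G.edgeSet → Fin d → (G.edgeSet → ℝ) →L[ℝ] ℝ := fun e i =>
    LinearMap.toContinuousLinearMap
      ((LinearMap.proj (R := ℝ) (φ := fun _ : V × Fin d => ℝ) ((Quot.out e.1).1, i) -
        LinearMap.proj ((Quot.out e.1).2, i)) ∘ₗ B)
  have hψ : ∀ e i y, ψ e i y = B y ((Quot.out e.1).1, i) - B y ((Quot.out e.1).2, i) :=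
    fun e i y => rfl
  have hf : ∀ y e, f y e = f 0 e + y e + (∑ i, ψ e i y ^ 2) / 2 := by
    intro y e
    have h1 := congrFun (LinearMap.congr_fun hB y) e
    rw [LinearMap.comp_apply, Matrix.mulVecLin_apply] at h1
    have h2 := rigidityMatrix_mulVec (G := G) (edgeDir fun v i => p v i)
      (fun v i => B y (v, i)) e
    have h3 := h2.symm.trans h1
    rw [LinearMap.id_apply] at h3
    simp only [f, dist_sq_eq, ← h3, hP0, hψ, Finset.sum_div, ← Finset.sum_add_distrib]
    refine Finset.sum_congr rfl fun i _ => ?_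
    simp only [P, edgeDir]
    ring
  have hder : HasStrictFDerivAt f
      ((ContinuousLinearEquiv.refl ℝ (G.edgeSet → ℝ) : (G.edgeSet → ℝ) →L[ℝ] (G.edgeSet → ℝ)))
      0 := by
    have hf' : f = fun y e => f 0 e + y e + (∑ i, ψ e i y ^ 2) / 2 := by
      ext y e
      exact hf y e
    rw [hf', hasStrictFDerivAt_pi']
    intro e
    have h1 : HasStrictFDerivAt (fun y : G.edgeSet → ℝ => (∑ i, ψ e i y ^ 2) / 2)
        (0 : (G.edgeSet → ℝ) →L[ℝ] ℝ) 0 := by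
      have h2 : HasStrictFDerivAt (fun y : G.edgeSet → ℝ => ∑ i, ψ e i y ^ 2)
          (∑ i : Fin d, (0 : (G.edgeSet → ℝ) →L[ℝ] ℝ)) 0 := by
        refine HasStrictFDerivAt.fun_sum fun i _ => ?_
        have := (ψ e i).hasStrictFDerivAt (x := 0) |>.pow 2
        simpa using this
      simpa [div_eq_mul_inv] using h2.mul_const (2⁻¹ : ℝ)
    have h3 : HasStrictFDerivAt (fun y : G.edgeSet → ℝ => y e)
        (ContinuousLinearMap.proj e : (G.edgeSet → ℝ) →L[ℝ] ℝ) 0 :=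
      (ContinuousLinearMap.proj (R := ℝ) (φ := fun _ : G.edgeSet => ℝ) e).hasStrictFDerivAt
    have h4 := (h3.const_add (f 0 e)).add h1
    rw [add_zero] at h4
    exact h4
  let H := hder.toOpenPartialHomeomorph f
  have hHf : ∀ y, H y = f y := fun y => rfl
  have hsrc : (0 : G.edgeSet → ℝ) ∈ H.source := hder.mem_toOpenPartialHomeomorph_source
  have htgt : f 0 ∈ H.target := hder.image_mem_toOpenPartialHomeomorph_target
  let e₀ : G.edgeSet := ⟨s(a, b), hab⟩
  have hlin : Continuous fun ε : ℝ => f 0 + ε • (Pi.single e₀ 1 : G.edgeSet → ℝ) := by fun_prop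
  obtain ⟨r, hr, hball⟩ := Metric.mem_nhds_iff.1
    ((hlin.tendsto 0).eventually (H.open_target.mem_nhds (by simpa using htgt)))
  let y : unitInterval → G.edgeSet → ℝ := fun t => f 0 + ((t : ℝ) * (r / 2)) • Pi.single e₀ 1
  have hy : ∀ t, y t ∈ H.target := by
    intro t
    apply hball
    rw [Metric.mem_ball, dist_zero_right, Real.norm_eq_abs,
      abs_of_nonneg (mul_nonneg t.2.1 (by positivity))]
    nlinarith [t.2.1, t.2.2]
  have hyc : Continuous y := by fun_prop
  have hHy : Continuous fun t => H.symm (y t) :=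
    H.continuousOn_symm.comp_continuous hyc hy
  have hfy : ∀ t, f (H.symm (y t)) = y t := fun t => H.right_inv (hy t)
  have hdist : ∀ t u v (huv : G.Adj u v),
      dist (P (H.symm (y t)) u) (P (H.symm (y t)) v) ^ 2 =
        dist (p u) (p v) ^ 2 + 2 * ((t : ℝ) * (r / 2) *
          (Pi.single e₀ 1 : G.edgeSet → ℝ) ⟨s(u, v), huv⟩) := by
    intro t u v huv
    have he : s((Quot.out s(u, v)).1, (Quot.out s(u, v)).2) = s(u, v) := Quot.out_eq _
    have h1 : dist (P (H.symm (y t)) (Quot.out s(u, v)).1)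
        (P (H.symm (y t)) (Quot.out s(u, v)).2) ^ 2 / 2 =
        dist (P 0 (Quot.out s(u, v)).1) (P 0 (Quot.out s(u, v)).2) ^ 2 / 2 +
          (t : ℝ) * (r / 2) * (Pi.single e₀ 1 : G.edgeSet → ℝ) ⟨s(u, v), huv⟩ :=
      congrFun (hfy t) ⟨s(u, v), huv⟩
    rw [hP0] at h1
    rcases Sym2.eq_iff.1 he with ⟨e1, e2⟩ | ⟨e1, e2⟩
    · rw [e1, e2] at h1
      linarith
    · rw [e1, e2, dist_comm, dist_comm (p v)] at h1
      linarith
  refine ⟨fun t => P (H.symm (y t)), hPc.comp hHy, ?_, ?_, ?_⟩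
  · have : y 0 = H 0 := by simp [y, hHf]
    dsimp only
    rw [this, H.left_inv hsrc, hP0]
  · intro t u v huv hne
    rw [← sq_eq_sq₀ dist_nonneg dist_nonneg, hdist t u v huv]
    have : (⟨s(u, v), huv⟩ : G.edgeSet) ≠ e₀ := fun hh => hne (congrArg Subtype.val hh)
    simp [this]
  · intro heq
    have h1 := hdist 1 a b hab
    dsimp only at heq
    rw [heq] at h1
    have : (Pi.single e₀ 1 : G.edgeSet → ℝ) ⟨s(a, b), hab⟩ = 1 := Pi.single_eq_same _ _
    rw [this] at h1
    simp at h1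
    linarith

/-- A rigid framework with independent edges is minimally rigid. -/
theorem EdgesIndependent.isMinimallyRigid [Finite V] {p : V → EuclideanSpace ℝ (Fin d)}
    (h : EdgesIndependent G (edgeDir fun v i => p v i)) (hr : IsRigid G p) :
    IsMinimallyRigid G p := by
  refine ⟨hr, fun K hK hKG a b hab => ?_⟩
  by_contra hn
  obtain ⟨γ, hγ, h0, hlen, hab'⟩ := h.exists_movement hab
  obtain ⟨φ, hφ⟩ := hK γ hγ h0 (fun t u v huv => hlen t u v (hKG huv) fun he => by
    rw [← SimpleGraph.mem_edgeSet, he] at huv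
    exact hn huv) 1
  apply hab'
  rw [hφ, hφ, φ.dist_eq]

theorem continuous_aeval [Finite V] (Q : MvPolynomial (V × Fin d) ℚ) :
    Continuous fun p : V → Fin d → ℝ => MvPolynomial.aeval (fun w : V × Fin d => p w.1 w.2) Q := by
  have : ∀ p : V → Fin d → ℝ, MvPolynomial.aeval (fun w : V × Fin d => p w.1 w.2) Q =
      MvPolynomial.eval (fun w : V × Fin d => p w.1 w.2) (MvPolynomial.map (algebraMap ℚ ℝ) Q) := by
    intro p
    rw [MvPolynomial.eval_map, MvPolynomial.aeval_def]
  simp only [this]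
  exact (MvPolynomial.continuous_eval _).comp (by fun_prop)

/-- A graph with independent edges in some position and with the edge count of a minimally rigid
graph is generically minimally rigid. -/
theorem isGenericallyMinimallyRigid_of_edgesIndependent [Fintype V]
    (h : ∃ p : V → Fin d → ℝ, EdgesIndependent G (edgeDir p))
    (hcard : Fintype.card V * d ≤ G.edgeSet.ncard + (d + 1).choose 2)
    (hV : d + 1 ≤ Fintype.card V) : IsGenericallyMinimallyRigid d G := by
  classical
  obtain ⟨p₀, hp₀⟩ := h
  obtain ⟨c⟩ : Nonempty (Fin (d + 1) ↪ V) :=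
    Function.Embedding.nonempty_of_card_le (by simpa using hV)
  -- the polynomial that detects frameworks in an affine hyperplane
  let N : Matrix (Fin d) (Fin d) (MvPolynomial (V × Fin d) ℚ) :=
    Matrix.of fun k => edgeDir (fun v i => MvPolynomial.X (v, i)) (c k.succ) (c 0)
  have hN : ∀ p : V → Fin d → ℝ, MvPolynomial.aeval (fun w => p w.1 w.2) N.det =
      (Matrix.of fun k : Fin d => edgeDir p (c k.succ) (c 0)).det := by
    intro p
    rw [AlgHom.map_det]
    congr 1
    ext k j
    simp [N, edgeDir]
  have hN0 : N.det ≠ 0 := by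
    intro h0
    let q : V → Fin d → ℝ := fun x j => if x = c j.succ then 1 else 0
    have h1 := hN q
    have hone : (Matrix.of fun k : Fin d => edgeDir q (c k.succ) (c 0)) = 1 := by
      ext k j
      have : (0 : Fin (d + 1)) ≠ j.succ := (Fin.succ_ne_zero j).symm
      simp [q, edgeDir, Matrix.one_apply, this]
    rw [h0, map_zero, hone, Matrix.det_one] at h1
    exact zero_ne_one h1
  refine ⟨gramPoly d G * N.det, mul_ne_zero (gramPoly_ne_zero hp₀) hN0, fun p hp => ?_⟩
  have hev : ∀ᶠ q : V → Fin d → ℝ in nhds (fun v i => p v i), IsInfinitesimallyRigid G q := by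
    filter_upwards [(continuous_aeval (gramPoly d G * N.det)).continuousAt.eventually_ne
      (x := fun v i => p v i) hp] with q hq
    rw [map_mul] at hq
    have h1 := (aeval_gramPoly_ne_zero_iff q).1 (left_ne_zero_of_mul hq)
    have h2 := right_ne_zero_of_mul hq
    rw [hN] at h2
    exact h1.isInfinitesimallyRigid hcard h2
  refine EdgesIndependent.isMinimallyRigid ?_ (isRigid_of_eventually hev)
  rw [map_mul] at hp
  exact (aeval_gramPoly_ne_zero_iff fun v i => p v i).1 (left_ne_zero_of_mul hp)

end

/-! ### Crossings in a convex polygon -/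

section

variable {n : ℕ} {x : Fin n → EuclideanSpace ℝ (Fin 2)}

/-- Twice the signed area of the triangle `a b c`. -/
def orientation (a b c : EuclideanSpace ℝ (Fin 2)) : ℝ :=
  (b 0 - a 0) * (c 1 - a 1) - (b 1 - a 1) * (c 0 - a 0)

theorem IsConvexPolygon.orientation_pos (hx : IsConvexPolygon x) {i j l : Fin n} (hij : i < j)
    (hjl : j < l) : 0 < orientation (x i) (x j) (x l) := hx i j l hij hjl

theorem orientation_swap (a b c : EuclideanSpace ℝ (Fin 2)) :
    orientation a c b = -orientation a b c := by
  unfold orientation; ring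

theorem orientation_rotate (a b c : EuclideanSpace ℝ (Fin 2)) :
    orientation b c a = orientation a b c := by
  unfold orientation; ring

/-- The diagonals of a convex quadrilateral intersect. -/
theorem IsConvexPolygon.inter_nonempty (hx : IsConvexPolygon x) {a b c d : Fin n} (hab : a < b)
    (hbc : b < c) (hcd : c < d) :
    (openSegment ℝ (x a) (x c) ∩ openSegment ℝ (x b) (x d)).Nonempty := by
  have h1 := hx.orientation_pos hbc hcd
  have h2 := hx.orientation_pos hab (hbc.trans hcd)
  have h3 := hx.orientation_pos (hab.trans hbc) hcd
  have h4 := hx.orientation_pos hab hbc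
  -- both diagonals are divided in the ratio of areas; the two total areas agree
  set α := orientation (x b) (x c) (x d) with hα
  set γ := orientation (x a) (x b) (x d) with hγ
  set β := orientation (x a) (x c) (x d) with hβ
  set δ := orientation (x a) (x b) (x c) with hδ
  have hsum : β + δ = α + γ := by
    rw [hα, hβ, hγ, hδ]; unfold orientation; ring
  have hpos : 0 < α + γ := by positivity
  refine ⟨(α / (α + γ)) • x a + (γ / (α + γ)) • x c,
    ⟨α / (α + γ), γ / (α + γ), by positivity, by positivity, by field_simp, rfl⟩,
    ⟨β / (α + γ), δ / (α + γ), by positivity, by positivity, ?_, ?_⟩⟩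
  · rw [← add_div, hsum, div_self hpos.ne']
  · ext i
    simp only [PiLp.add_apply, PiLp.smul_apply, smul_eq_mul]
    rw [div_mul_eq_mul_div, div_mul_eq_mul_div, div_mul_eq_mul_div, div_mul_eq_mul_div, ← add_div,
      ← add_div]
    congr 1
    rw [hα, hβ, hγ, hδ]
    unfold orientation
    fin_cases i <;> simp only [Fin.zero_eta, Fin.mk_one] <;> ring

/-- If both endpoints of `]c, d[` lie on one side of the line through `a` and `b`, not both on the
line, then `]a, b[` and `]c, d[` are disjoint. -/
theorem not_inter_nonempty {a b c d : EuclideanSpace ℝ (Fin 2)}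
    (h : (0 ≤ orientation a b c ∧ 0 ≤ orientation a b d ∧
        (0 < orientation a b c ∨ 0 < orientation a b d)) ∨
      (orientation a b c ≤ 0 ∧ orientation a b d ≤ 0 ∧
        (orientation a b c < 0 ∨ orientation a b d < 0))) :
    ¬ (openSegment ℝ a b ∩ openSegment ℝ c d).Nonempty := by
  rintro ⟨_, ⟨s, t, hs, ht, hst, rfl⟩, s', t', hs', ht', hst', heq⟩
  have h0 : s' * orientation a b c + t' * orientation a b d = 0 := by
    have e0 := congrArg (fun z : EuclideanSpace ℝ (Fin 2) => z 0) heq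
    have e1 := congrArg (fun z : EuclideanSpace ℝ (Fin 2) => z 1) heq
    simp only [PiLp.add_apply, PiLp.smul_apply, smul_eq_mul] at e0 e1
    obtain rfl : s = 1 - t := by linarith
    obtain rfl : s' = 1 - t' := by linarith
    unfold orientation
    linear_combination (b 0 - a 0) * e1 - (b 1 - a 1) * e0
  rcases h with ⟨h1, h2, h3 | h3⟩ | ⟨h1, h2, h3 | h3⟩
  · nlinarith [mul_pos hs' h3, mul_nonneg ht'.le h2]
  · nlinarith [mul_pos ht' h3, mul_nonneg hs'.le h1]
  · nlinarith [mul_pos hs' (neg_pos.2 h3), mul_nonneg ht'.le (neg_nonneg.2 h2)]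
  · nlinarith [mul_pos ht' (neg_pos.2 h3), mul_nonneg hs'.le (neg_nonneg.2 h1)]

/-- For distinct edges, the open segments intersect exactly if the endpoints interleave. -/
theorem IsConvexPolygon.inter_nonempty_iff (hx : IsConvexPolygon x) {p q r s : Fin n}
    (hpq : p ≠ q) (hrs : r ≠ s) (hne : s(p, q) ≠ s(r, s)) :
    (openSegment ℝ (x p) (x q) ∩ openSegment ℝ (x r) (x s)).Nonempty ↔
      Crosses (fun i : Fin n => (i : ℕ)) p q r s := by
  wlog hlt : p < q generalizing p q
  · have := this hpq.symm (by rwa [Sym2.eq_swap]) (lt_of_le_of_ne (not_lt.1 hlt) hpq.symm)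
    rw [openSegment_symm, this]
    unfold Crosses Interleave
    omega
  wlog hlt' : r < s generalizing r s
  · have := this hrs.symm (by rwa [Sym2.eq_swap (a := s)])
      (lt_of_le_of_ne (not_lt.1 hlt') hrs.symm)
    rw [openSegment_symm ℝ (x r), this]
    unfold Crosses Interleave
    omega
  constructor
  · contrapose
    intro hc
    have hin : ∀ z, p < z → z < q → orientation (x p) (x q) (x z) < 0 := by
      intro z h1 h2
      rw [orientation_swap]
      exact neg_neg_of_pos (hx.orientation_pos h1 h2)
    have hout : ∀ z, z < p ∨ q < z → 0 < orientation (x p) (x q) (x z) := by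
      rintro z (h1 | h1)
      · rw [orientation_rotate (x z)]
        exact hx.orientation_pos h1 hlt
      · exact hx.orientation_pos hlt h1
    have hp : orientation (x p) (x q) (x p) = 0 := by unfold orientation; ring
    have hq : orientation (x p) (x q) (x q) = 0 := by unfold orientation; ring
    have hcase : ∀ z, orientation (x p) (x q) (x z) = 0 ∧ (z = p ∨ z = q) ∨
        (orientation (x p) (x q) (x z) < 0 ∧ p < z ∧ z < q) ∨
        (0 < orientation (x p) (x q) (x z) ∧ (z < p ∨ q < z)) := by
      intro z
      rcases lt_trichotomy z p with h1 | rfl | h1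
      · exact Or.inr (Or.inr ⟨hout z (Or.inl h1), Or.inl h1⟩)
      · exact Or.inl ⟨hp, Or.inl rfl⟩
      · rcases lt_trichotomy z q with h2 | rfl | h2
        · exact Or.inr (Or.inl ⟨hin z h1 h2, h1, h2⟩)
        · exact Or.inl ⟨hq, Or.inr rfl⟩
        · exact Or.inr (Or.inr ⟨hout z (Or.inr h2), Or.inr h2⟩)
    apply not_inter_nonempty
    unfold Crosses Interleave at hc
    simp only [Fin.val_fin_lt] at hc
    rcases hcase r with ⟨h1, h1'⟩ | ⟨h1, h1'⟩ | ⟨h1, h1'⟩ <;>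
    rcases hcase s with ⟨h2, h2'⟩ | ⟨h2, h2'⟩ | ⟨h2, h2'⟩
    · exfalso
      rcases h1' with rfl | rfl <;> rcases h2' with rfl | rfl
      · exact hrs rfl
      · exact hne rfl
      · exact hne Sym2.eq_swap
      · exact hrs rfl
    · exact Or.inr ⟨h1.le, h2.le, Or.inr h2⟩
    · exact Or.inl ⟨h1.ge, h2.le, Or.inr h2⟩
    · exact Or.inr ⟨h1.le, h2.le, Or.inl h1⟩
    · exact Or.inr ⟨h1.le, h2.le, Or.inl h1⟩
    · exact absurd (Or.inl ⟨h1'.1, h1'.2, h2'⟩) hc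
    · exact Or.inl ⟨h1.le, h2.ge, Or.inl h1⟩
    · exact absurd (Or.inr (Or.inl ⟨h2'.1, h2'.2, h1'⟩)) hc
    · exact Or.inl ⟨h1.le, h2.le, Or.inl h1⟩
  · intro hc
    have hc' : (p < r ∧ r < q ∧ q < s) ∨ (r < p ∧ p < s ∧ s < q) := by
      unfold Crosses Interleave at hc
      dsimp only at hc
      omega
    rcases hc' with ⟨h1, h2, h3⟩ | ⟨h1, h2, h3⟩
    · exact hx.inter_nonempty h1 h2 h3
    · rw [Set.inter_comm]
      exact hx.inter_nonempty h1 h2 h3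

theorem Crosses.ne {V : Type*} {ℓ : V → ℕ} {p q r s : V} (h : Crosses ℓ p q r s) :
    p ≠ q ∧ r ≠ s ∧ s(p, q) ≠ s(r, s) := by
  unfold Crosses Interleave at h
  refine ⟨?_, ?_, ?_⟩
  · rintro rfl; omega
  · rintro rfl; omega
  · intro he
    rcases Sym2.eq_iff.1 he with ⟨rfl, rfl⟩ | ⟨rfl, rfl⟩ <;> omega

theorem IsConvexPolygon.cross_iff (hx : IsConvexPolygon x) {p q r s : Fin n}
    (hpq : p ≠ q) (hrs : r ≠ s) (hne : s(p, q) ≠ s(r, s)) :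
    Cross x s(p, q) s(r, s) ↔ Crosses (fun i : Fin n => (i : ℕ)) p q r s := by
  rw [← hx.inter_nonempty_iff hpq hrs hne]
  constructor
  · rintro ⟨u, v, u', v', h1, h2, h3⟩
    rcases Sym2.eq_iff.1 h1 with ⟨rfl, rfl⟩ | ⟨rfl, rfl⟩ <;>
    rcases Sym2.eq_iff.1 h2 with ⟨rfl, rfl⟩ | ⟨rfl, rfl⟩
    · exact h3
    · rwa [openSegment_symm ℝ (x r)]
    · rwa [openSegment_symm ℝ (x p)]
    · rwa [openSegment_symm ℝ (x p), openSegment_symm ℝ (x r)]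
  · exact fun h => ⟨p, q, r, s, rfl, rfl, h⟩

/-- A graph is `3`-crossing-free exactly if it has no three pairwise crossing edges, in
combinatorial terms. -/
theorem IsConvexPolygon.crossingFree_iff (hx : IsConvexPolygon x) {G : SimpleGraph (Fin n)} :
    CrossingFree x 3 G ↔ ∀ p q r s t w, G.Adj p q → G.Adj r s → G.Adj t w →
      Crosses (fun i : Fin n => (i : ℕ)) p q r s → Crosses (fun i : Fin n => (i : ℕ)) p q t w →
      Crosses (fun i : Fin n => (i : ℕ)) r s t w → False := by
  have hcomm : ∀ p q r s, Crosses (fun i : Fin n => (i : ℕ)) p q r s →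
      Crosses (fun i : Fin n => (i : ℕ)) r s p q := by
    intro p q r s
    unfold Crosses Interleave
    omega
  constructor
  · intro h p q r s t w h1 h2 h3 c1 c2 c3
    refine h {s(p, q), s(r, s), s(t, w)} ?_ ⟨?_, ?_⟩
    · intro e he
      simp only [Finset.coe_insert, Finset.coe_singleton, Set.mem_insert_iff,
        Set.mem_singleton_iff] at he
      rcases he with rfl | rfl | rfl
      exacts [h1, h2, h3]
    · rw [Finset.card_eq_three]
      exact ⟨_, _, _, c1.ne.2.2, c2.ne.2.2, c3.ne.2.2, rfl⟩
    · have key : ∀ p q r s, Crosses (fun i : Fin n => (i : ℕ)) p q r s →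
          Cross x s(p, q) s(r, s) ∧ Cross x s(r, s) s(p, q) := fun p q r s c =>
        ⟨(hx.cross_iff c.ne.1 c.ne.2.1 c.ne.2.2).2 c,
          (hx.cross_iff c.ne.2.1 c.ne.1 c.ne.2.2.symm).2 (hcomm _ _ _ _ c)⟩
      intro e he f hf hef
      simp only [Finset.coe_insert, Finset.coe_singleton, Set.mem_insert_iff,
        Set.mem_singleton_iff] at he hf
      rcases he with rfl | rfl | rfl <;> rcases hf with rfl | rfl | rfl
      exacts [absurd rfl hef, (key _ _ _ _ c1).1, (key _ _ _ _ c2).1, (key _ _ _ _ c1).2,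
        absurd rfl hef, (key _ _ _ _ c3).1, (key _ _ _ _ c2).2, (key _ _ _ _ c3).2,
        absurd rfl hef]
  · rintro h C hC ⟨hcard, hpair⟩
    obtain ⟨e, f, g, hef, heg, hfg, rfl⟩ := Finset.card_eq_three.1 hcard
    have me := hC (show e ∈ _ by simp)
    have mf := hC (show f ∈ _ by simp)
    have mg := hC (show g ∈ _ by simp)
    have c1 := hpair (show e ∈ _ by simp) (show f ∈ _ by simp) hef
    have c2 := hpair (show e ∈ _ by simp) (show g ∈ _ by simp) heg
    have c3 := hpair (show f ∈ _ by simp) (show g ∈ _ by simp) hfg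
    clear hpair hcard hC
    induction e with | _ p q =>
    induction f with | _ r s =>
    induction g with | _ t w =>
    rw [SimpleGraph.mem_edgeSet] at me mf mg
    rw [hx.cross_iff me.ne mf.ne hef] at c1
    rw [hx.cross_iff me.ne mg.ne heg] at c2
    rw [hx.cross_iff mf.ne mg.ne hfg] at c3
    exact h p q r s t w me mf mg c1 c2 c3

theorem IsMultiTriangulation.isTwoTriangulation (hx : IsConvexPolygon x)
    {T : SimpleGraph (Fin n)} (hT : IsMultiTriangulation x 2 T) :
    IsTwoTriangulation (fun i : Fin n => (i : ℕ)) Finset.univ T := by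
  have hfree := hx.crossingFree_iff.1 hT.1
  refine ⟨Fin.val_injective, fun _ => Finset.mem_univ _, hfree, ?_⟩
  intro a _ b _ hab hn
  by_contra hc
  push Not at hc
  -- otherwise the edge `a b` could be added
  have hcomm : ∀ p q r s, Crosses (fun i : Fin n => (i : ℕ)) p q r s →
      Crosses (fun i : Fin n => (i : ℕ)) r s p q := by
    intro p q r s
    unfold Crosses Interleave
    omega
  have hswap : ∀ p q r s, Crosses (fun i : Fin n => (i : ℕ)) p q r s →
      Crosses (fun i : Fin n => (i : ℕ)) q p r s := by
    intro p q r s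
    unfold Crosses Interleave
    omega
  have hself : ∀ p q, ¬ Crosses (fun i : Fin n => (i : ℕ)) p q p q := fun p q h =>
    h.ne.2.2 rfl
  have hself' : ∀ p q, ¬ Crosses (fun i : Fin n => (i : ℕ)) p q q p := fun p q h =>
    h.ne.2.2 Sym2.eq_swap
  have hmax := hT.2 (y := T ⊔ SimpleGraph.edge a b) ?_ le_sup_left
  · exact hn (hmax (Or.inr (by simp [SimpleGraph.edge_adj, hab])))
  refine hx.crossingFree_iff.2 ?_
  intro p q r s t w h1 h2 h3 c1 c2 c3
  simp only [SimpleGraph.sup_adj, SimpleGraph.edge_adj] at h1 h2 h3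
  rcases h1 with h1 | ⟨⟨rfl, rfl⟩ | ⟨rfl, rfl⟩, -⟩ <;>
  rcases h2 with h2 | ⟨⟨rfl, rfl⟩ | ⟨rfl, rfl⟩, -⟩ <;>
  rcases h3 with h3 | ⟨⟨rfl, rfl⟩ | ⟨rfl, rfl⟩, -⟩ <;>
  first
    | exact hself _ _ ‹_›
    | exact hself' _ _ ‹_›
    | exact hfree _ _ _ _ _ _ h1 h2 h3 c1 c2 c3
    | exact hc _ _ _ _ h2 h3 c1 c2 c3
    | exact hc _ _ _ _ h2 h3 (hswap _ _ _ _ c1) (hswap _ _ _ _ c2) c3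
    | exact hc _ _ _ _ h1 h3 (hcomm _ _ _ _ c1) c3 c2
    | exact hc _ _ _ _ h1 h3 (hswap _ _ _ _ (hcomm _ _ _ _ c1)) (hswap _ _ _ _ c3) c2
    | exact hc _ _ _ _ h1 h2 (hcomm _ _ _ _ c2) (hcomm _ _ _ _ c3) c1
    | exact hc _ _ _ _ h1 h2 (hswap _ _ _ _ (hcomm _ _ _ _ c2))
        (hswap _ _ _ _ (hcomm _ _ _ _ c3)) c1

end
end MultiTri

/-! ### Generic minimal rigidity of two-triangulations -/

theorem theorem8p6 (n : ℕ) (hn : 5 ≤ n) (x : Fin n → EuclideanSpace ℝ (Fin 2))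
    (hx : MultiTri.IsConvexPolygon x) (T : SimpleGraph (Fin n))
    (hT : MultiTri.IsMultiTriangulation x 2 T) :
    MultiTri.IsGenericallyMinimallyRigid 4 T := by
  obtain ⟨h1, h2⟩ := (MultiTri.IsMultiTriangulation.isTwoTriangulation hx
    hT).exists_edgesIndependent (n - 5) (by rw [Finset.card_univ, Fintype.card_fin]; omega)
  rw [Finset.card_univ, Fintype.card_fin] at h2
  refine MultiTri.isGenericallyMinimallyRigid_of_edgesIndependent h1 ?_ ?_
  · have h10 : Nat.choose (4 + 1) 2 = 10 := rfl
    rw [Fintype.card_fin, h10]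
    omega
  · rw [Fintype.card_fin]
    exact hn
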